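/- **Theorem.** Let $E=(E^0,E^1,r,s)$ be a finite directed graph without sources (i.e. $r^{-1}(x)\neq\emptyset$ for every $x\in E^0$), let $G$ be a (discrete) group acting on $E$ by graph automorphisms, and let $\varphi:G\times E^1\to G$ be a 1-cocycle, $\varphi(gh,a)=\varphi(g,ha)\,\varphi(h,a)$, such that $\varphi(g,a)\cdot x=g\cdot x$ for all $g\in G$, $a\in E^1$, $x\in E^0$. Let $R$ be any unital commutative ring. *Paths.* A finite path is a vertex $x$ (length $0$, with range and source $x$) or a word $\alpha=a_1\cdots a_n$ of edges with $s(a_i)=r(a_{i+1})$; its range is $r(a_1)$ and its source is $d(\alpha)=s(a_n)$. Let $E^*$ be the set of finite paths and $E^\infty$ the set of infinite paths $a_1a_2\cdots$, and let $Z(\gamma)\subseteq E^\infty$ be the set of infinite paths that begin with $\gamma\in E^*$. The action and the cocycle extend to paths by $g(a\alpha)=(ga)(\varphi(g,a)\alpha)$, $\varphi(g,a\alpha)=\varphi(\varphi(g,a),\alpha)$ and $\varphi(g,x)=g$ for $x\in E^0$. *Groupoid.* Let $\mathcal S_{G,E}=\{(\alpha,g,\beta):\alpha,\beta\in E^*,\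 g\in G,\ d(\alpha)=g\,d(\beta)\}\cup\{0\}$, with product $$(\alpha,g,\beta)(\gamma,h,\delta)=\begin{cases}(\alpha\,(g\varepsilon),\ \varphi(g,\varepsilon)h,\ \delta)&\text{if }\gamma=\beta\varepsilon,\\ (\alpha,\ g\,\varphi(h^{-1},\varepsilon)^{-1},\ \delta\,(h^{-1}\varepsilon))&\text{if }\beta=\gamma\varepsilon,\\ 0&\text{otherwise,}\end{cases}$$ and $(\alpha,g,\beta)^*=(\beta,g^{-1},\alpha)$. It acts on $E^\infty$ by $(\alpha,g,\beta)\cdot\beta\xi=\alpha(g\xi)$. Let $\mathcal G_{(G,E)}$ be its groupoid of germs $[\alpha,g,\beta;\eta]$, $\eta\in Z(\beta)$, where $[s;\eta]=[t;\mu]$ iff $\eta=\mu$ and there is an idempotent $e\neq0$ of $\mathcal S_{G,E}$ with $e\cdot\eta=\eta$ and $se=te$. The germ $[s;\eta]$ has source $\eta$ and range $s\cdot\eta$, and $[s;t\cdot\eta][t;\eta]=[st;\eta]$, $[s;\eta]^{-1}=[s^*;s\cdot\eta]$. Its topology has as a basis the sets $\Theta((\alpha,g,\beta),Z(\gamma))$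 of all germs $[\alpha,g,\beta;\xi]$ with $\xi\in Z(\gamma)\cap Z(\beta)$. Let $A_R(\mathcal G_{(G,E)})$ be its Steinberg algebra, that is, the $R$-linear span, in the functions $\mathcal G_{(G,E)}\to R$, of the characteristic functions of compact open bisections, with the convolution product. (If $\mathcal G_{(G,E)}$ is Hausdorff, this is the algebra of all locally constant, compactly supported functions.) *Algebra.* Let $\mathcal O^{\mathrm{alg}}_{(G,E)}(R)$ be the universal unital $R$-algebra with generators $p_x$ ($x\in E^0$), $s_a,s_a^*$ ($a\in E^1$), $u_g$ ($g\in G$) and relations 1. $p_xp_y=\delta_{x,y}p_x$ and $\sum_{x\in E^0}p_x=1$; $\;p_{r(a)}s_a=s_a=s_ap_{s(a)}$ and $p_{s(a)}s_a^*=s_a^*=s_a^*p_{r(a)}$; $\;s_a^*s_b=\delta_{a,b}\,p_{s(a)}$; $\;p_x=\sum_{r(a)=x}s_as_a^*$; 2. $u_1=1$ and $u_{gh}=u_gu_h$; 3. $u_gs_a=s_{ga}u_{\varphi(g,a)}$ and $s_a^*u_{g^{-1}}=u_{\varphi(g,a)^{-1}}s_{ga}^*$; 4. $u_gp_x=p_{gx}u_g$.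 For $\alpha=a_1\cdots a_n$ with $n\geq1$ put $s_\alpha=s_{a_1}\cdots s_{a_n}$ and $s_\alpha^*=s_{a_n}^*\cdots s_{a_1}^*$; for a vertex $x$ put $s_x=s_x^*=p_x$. Then there is an isomorphism of $R$-algebras $\phi:A_R(\mathcal G_{(G,E)})\to\mathcal O^{\mathrm{alg}}_{(G,E)}(R)$ such that $\phi\bigl(1_{\Theta((\alpha,g,\beta),Z(\beta))}\bigr)=s_\alpha u_gs_\beta^*$ for all $\alpha,\beta\in E^*$ and $g\in G$ with $d(\alpha)=g\,d(\beta)$. -/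

import Mathlib

namespace ExelPardo

open CategoryTheory Filter

/-- The data of a triple `(G, E, φ)`: a directed graph `E` without sources, with vertex set `V`,
edge set `A`, range `r` and source `s`; the group `G` acts on `E` by graph automorphisms, and
`φ` is a one-cocycle for the action on edges that is compatible with the action on vertices.
(The finiteness of `V` and `A` is imposed by type class arguments where it is used.) -/
structure GraphTriple (G V A : Type*) [Group G] [MulAction G V] [MulAction G A] where
  r : A → V
  s : A → V
  no_sources : ∀ x : V, ∃ a : A, r a = x
  r_smul : ∀ (g : G) (a : A), r (g • a) = g • r a
  s_smul : ∀ (g : G) (a : A), s (g • a) = g • s a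
  φ : G → A → G
  φ_mul : ∀ (g h : G) (a : A), φ (g * h) a = φ g (h • a) * φ h a
  φ_smul : ∀ (g : G) (a : A) (x : V), φ g a • x = g • x

variable {G V A : Type*} [Group G] [MulAction G V] [MulAction G A]

namespace GraphTriple

variable (T : GraphTriple G V A)

/-! ### Finite paths -/

/-- `T.IsPath x [a₁, …, aₙ]`: the edges satisfy `r a₁ = x` and `s aᵢ = r aᵢ₊₁`. -/
def IsPath : V → List A → Prop
  | _, [] => True
  | x, a :: l => T.r a = x ∧ IsPath (T.s a) l

/-- The source of the last edge of the list, or `x` if the list is empty. -/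
def endVertex : V → List A → V
  | x, [] => x
  | _, a :: l => endVertex (T.s a) l

/-- The action of `g` on (lists of edges of) finite paths, `g (a l) = (g a) (φ(g, a) l)`. -/
def act : G → List A → List A
  | _, [] => []
  | g, a :: l => (g • a) :: act (T.φ g a) l

/-- The extension of the cocycle to finite paths, `φ(g, a l) = φ(φ(g, a), l)`, with
`φ(g, x) = g` on vertices. -/
def coc : G → List A → G
  | g, [] => g
  | g, a :: l => coc (T.φ g a) l

variable {T}

theorem isPath_append {x : V} {l m : List A} :
    T.IsPath x (l ++ m) ↔ T.IsPath x l ∧ T.IsPath (T.endVertex x l) m := by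
  induction l generalizing x with
  | nil => simp [IsPath, endVertex]
  | cons a l ih => simp [IsPath, endVertex, ih, and_assoc]

theorem endVertex_append {x : V} {l m : List A} :
    T.endVertex x (l ++ m) = T.endVertex (T.endVertex x l) m := by
  induction l generalizing x with
  | nil => simp [endVertex]
  | cons a l ih => simp [endVertex, ih]

theorem φ_one (a : A) : T.φ 1 a = 1 := by
  have := T.φ_mul 1 1 a
  simpa using this

@[simp] theorem act_nil (g : G) : T.act g [] = [] := rfl
@[simp] theorem coc_nil (g : G) : T.coc g [] = g := rfl

@[simp] theorem length_act (g : G) (l : List A) : (T.act g l).length = l.length := by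
  induction l generalizing g with
  | nil => rfl
  | cons a l ih => simp [act, ih]

theorem act_append (g : G) (l m : List A) :
    T.act g (l ++ m) = T.act g l ++ T.act (T.coc g l) m := by
  induction l generalizing g with
  | nil => rfl
  | cons a l ih => simp [act, coc, ih]

theorem coc_append (g : G) (l m : List A) :
    T.coc g (l ++ m) = T.coc (T.coc g l) m := by
  induction l generalizing g with
  | nil => rfl
  | cons a l ih => simp [coc, ih]

theorem act_mul (g h : G) (l : List A) : T.act (g * h) l = T.act g (T.act h l) := by
  induction l generalizing g h with
  | nil => rfl
  | cons a l ih => simp [act, ih, T.φ_mul, mul_smul]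

theorem coc_mul (g h : G) (l : List A) :
    T.coc (g * h) l = T.coc g (T.act h l) * T.coc h l := by
  induction l generalizing g h with
  | nil => rfl
  | cons a l ih => simp [act, coc, ih, T.φ_mul]

@[simp] theorem act_one (l : List A) : T.act 1 l = l := by
  induction l with
  | nil => rfl
  | cons a l ih => simp [act, φ_one, ih]

@[simp] theorem coc_one (l : List A) : T.coc 1 l = 1 := by
  induction l with
  | nil => rfl
  | cons a l ih => simp [coc, φ_one, ih]

theorem coc_inv (g : G) (l : List A) : T.coc g⁻¹ (T.act g l) = (T.coc g l)⁻¹ := by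
  have := T.coc_mul g⁻¹ g l
  rw [inv_mul_cancel, coc_one] at this
  exact eq_inv_of_mul_eq_one_left this.symm

theorem coc_inv' (g : G) (l : List A) : T.coc g (T.act g⁻¹ l) = (T.coc g⁻¹ l)⁻¹ := by
  simpa using T.coc_inv g⁻¹ l

theorem act_inv_act (g : G) (l : List A) : T.act g⁻¹ (T.act g l) = l := by
  rw [← act_mul, inv_mul_cancel, act_one]

theorem act_act_inv (g : G) (l : List A) : T.act g (T.act g⁻¹ l) = l := by
  rw [← act_mul, mul_inv_cancel, act_one]

theorem coc_smul (g : G) (l : List A) (x : V) : T.coc g l • x = g • x := by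
  induction l generalizing g with
  | nil => rfl
  | cons a l ih => simp [coc, ih, T.φ_smul]

theorem isPath_act {x : V} {l : List A} (g : G) (h : T.IsPath x l) :
    T.IsPath (g • x) (T.act g l) := by
  induction l generalizing x g with
  | nil => trivial
  | cons a l ih =>
    refine ⟨by rw [T.r_smul, h.1], ?_⟩
    have := ih (T.φ g a) h.2
    rwa [T.φ_smul, ← T.s_smul] at this

theorem endVertex_act (g : G) (x : V) (l : List A) :
    T.endVertex (g • x) (T.act g l) = g • T.endVertex x l := by
  induction l generalizing x g with
  | nil => rfl
  | cons a l ih =>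
    simp only [act, endVertex]
    rw [T.s_smul, ← T.φ_smul g a, ih, T.φ_smul]

theorem IsPath.unique {x y : V} {l : List A} (h : T.IsPath x l) (h' : T.IsPath y l)
    (hl : l ≠ []) : x = y := by
  cases l with
  | nil => exact absurd rfl hl
  | cons a l => exact h.1.symm.trans h'.1

variable (T)

/-- Finite paths in `E`, including the paths of length zero, which are the vertices. -/
@[ext] structure FinPath where
  /-- the range of the path -/
  rng : V
  /-- the edges `a₁, …, aₙ` of the path -/
  edges : List A
  valid : T.IsPath rng edges

/-- The source `d(α)` of a finite path. -/
def FinPath.d {T : GraphTriple G V A} (α : T.FinPath) : V := T.endVertex α.rng α.edges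

/-- The concatenation of `α` with a list of edges that continues it. -/
def FinPath.extend {T : GraphTriple G V A} (α : T.FinPath) (ε : List A)
    (h : T.IsPath α.d ε) : T.FinPath :=
  ⟨α.rng, α.edges ++ ε, isPath_append.2 ⟨α.valid, h⟩⟩

theorem FinPath.d_extend {T : GraphTriple G V A} (α : T.FinPath) (ε : List A)
    (h : T.IsPath α.d ε) : (α.extend ε h).d = T.endVertex α.d ε :=
  endVertex_append

/-! ### The inverse semigroup -/

/-- The nonzero elements `(α, g, β)`, `d(α) = g d(β)`, of the inverse semigroup of `(G, E, φ)`. -/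
@[ext] structure Triple where
  α : T.FinPath
  g : G
  β : T.FinPath
  d_eq : α.d = g • β.d

/-- The inverse semigroup of `(G, E, φ)`: all triples `(α, g, β)` with `d(α) = g d(β)`, together
with a zero element (represented by `none`). -/
def SGE := Option T.Triple

/-- `γ = β ε`: the finite path `β` is an initial segment of `γ`. -/
def FinPath.IsPrefix {T : GraphTriple G V A} (β γ : T.FinPath) : Prop :=
  β.rng = γ.rng ∧ β.edges <+: γ.edges

/-- The list of edges `ε` with `γ = β ε`, if `β` is an initial segment of `γ`. -/
def FinPath.remainder {T : GraphTriple G V A} (β γ : T.FinPath) : List A :=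
  γ.edges.drop β.edges.length

variable {T}

theorem FinPath.IsPrefix.append_remainder {β γ : T.FinPath} (h : β.IsPrefix γ) :
    β.edges ++ β.remainder γ = γ.edges := by
  obtain ⟨ε, hε⟩ := h.2
  simp [FinPath.remainder, ← hε]

theorem FinPath.IsPrefix.isPath {β γ : T.FinPath} (h : β.IsPrefix γ) :
    T.IsPath β.d (β.remainder γ) := by
  have := γ.valid
  rw [← h.append_remainder, isPath_append, ← h.1] at this
  exact this.2

theorem FinPath.IsPrefix.d_eq {β γ : T.FinPath} (h : β.IsPrefix γ) :
    γ.d = T.endVertex β.d (β.remainder γ) := by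
  rw [FinPath.d, ← h.append_remainder, endVertex_append, ← h.1, FinPath.d]

open Classical in
/-- The product of two nonzero elements:
`(α, g, β) (γ, h, δ) = (α (g ε), φ(g, ε) h, δ)` if `γ = β ε`,
`(α, g, β) (γ, h, δ) = (α, g φ(h⁻¹, ε)⁻¹, δ (h⁻¹ ε))` if `β = γ ε`,
and zero (that is, `none`) otherwise. -/
noncomputable def Triple.mul (s t : T.Triple) : Option T.Triple :=
  if h : s.β.IsPrefix t.α then
    some
      { α := s.α.extend (T.act s.g (s.β.remainder t.α)) (by
          rw [s.d_eq]; exact isPath_act _ h.isPath)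
        g := T.coc s.g (s.β.remainder t.α) * t.g
        β := t.β
        d_eq := by
          rw [FinPath.d_extend, s.d_eq, endVertex_act, mul_smul, coc_smul, ← t.d_eq, h.d_eq] }
  else if h : t.α.IsPrefix s.β then
    some
      { α := s.α
        g := s.g * (T.coc t.g⁻¹ (t.α.remainder s.β))⁻¹
        β := t.β.extend (T.act t.g⁻¹ (t.α.remainder s.β)) (by
          have : t.β.d = t.g⁻¹ • t.α.d := by rw [t.d_eq, inv_smul_smul]
          rw [this]; exact isPath_act _ h.isPath)
        d_eq := by
          have : t.β.d = t.g⁻¹ • t.α.d := by rw [t.d_eq, inv_smul_smul]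
          rw [FinPath.d_extend, s.d_eq, this, endVertex_act, mul_smul, h.d_eq,
            ← coc_smul t.g⁻¹ (t.α.remainder s.β), inv_smul_smul] }
  else none

/-- `(α, g, β)* = (β, g⁻¹, α)`. -/
def Triple.star (s : T.Triple) : T.Triple :=
  ⟨s.β, s.g⁻¹, s.α, by rw [s.d_eq, inv_smul_smul]⟩

instance : Zero (SGE T) := ⟨(none : Option T.Triple)⟩

/-- The multiplication of the inverse semigroup, in which `0` is absorbing. -/
noncomputable instance : Mul (SGE T) :=
  ⟨fun s t => Option.bind s fun s' => Option.bind t fun t' => s'.mul t'⟩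

/-- A triple, as a nonzero element of the inverse semigroup. -/
def Triple.toSGE (s : T.Triple) : SGE T := some s

theorem toSGE_mul (s t : T.Triple) : s.toSGE * t.toSGE = s.mul t := rfl

variable (T)

/-! ### Infinite paths -/

/-- The space of infinite paths `a₀ a₁ a₂ …`, with `s aₙ = r aₙ₊₁`. -/
@[ext] structure InfPath where
  seq : Stream' A
  valid : ∀ n, T.s (seq n) = T.r (seq (n + 1))

/-- The action of `g` on infinite paths: the `n`-th edge of `g ξ` is `φ(g, ξ|ₙ) ξₙ`. -/
def actInf (g : G) (ξ : Stream' A) : Stream' A := fun n => T.coc g (ξ.take n) • ξ n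

variable {T}

/-- The range of an infinite path. -/
def InfPath.rng (ξ : T.InfPath) : V := T.r (ξ.seq 0)

/-- The cylinder `Z(γ)` of all infinite paths `γ ξ`. -/
def cylinder (γ : T.FinPath) : Set T.InfPath :=
  {η | ∃ ξ : T.InfPath, γ.d = ξ.rng ∧ η.seq = γ.edges ++ₛ ξ.seq}

/-- The action of the inverse semigroup on infinite paths, as a relation: `s.Maps η μ` says that
`η = β ξ` for some infinite path `ξ`, and `(α, g, β) · η = α (g ξ) = μ`. -/
def Triple.Maps (s : T.Triple) (η μ : T.InfPath) : Prop :=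
  ∃ ξ : T.InfPath, s.β.d = ξ.rng ∧ η.seq = s.β.edges ++ₛ ξ.seq ∧
    μ.seq = s.α.edges ++ₛ T.actInf s.g ξ.seq

/-- The germs of `s` and `t` at `η` agree: there is an idempotent `e ≠ 0` with `e · η = η` and
`s e = t e`. -/
def GermRel (η : T.InfPath) (s t : T.Triple) : Prop :=
  ∃ e : T.Triple, e.toSGE * e.toSGE = e.toSGE ∧ e.Maps η η ∧
    s.toSGE * e.toSGE = t.toSGE * e.toSGE

/-! ### Facts on infinite paths -/

theorem stream_take_append (l : List A) (ξ : Stream' A) (m : ℕ) :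
    (l ++ₛ ξ).take (l.length + m) = l ++ ξ.take m := by
  induction l with
  | nil => simp
  | cons a l ih =>
    rw [List.length_cons, Nat.add_right_comm, Stream'.cons_append_stream, Stream'.take_succ_cons,
      ih, List.cons_append]

theorem stream_append_inj {l m : List A} {ξ ζ : Stream' A} (h : l ++ₛ ξ = m ++ₛ ζ)
    (hl : l.length = m.length) : l = m ∧ ξ = ζ := by
  have h1 := congrArg (Stream'.take (l.length + 0)) h
  have h2 := congrArg (Stream'.drop l.length) h
  rw [stream_take_append] at h1
  rw [Stream'.drop_append_stream] at h2
  rw [hl] at h1 h2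
  rw [stream_take_append] at h1
  rw [Stream'.drop_append_stream] at h2
  exact ⟨by simpa using h1, h2⟩

theorem stream_append_left_cancel {l : List A} {ξ ζ : Stream' A} (h : l ++ₛ ξ = l ++ₛ ζ) :
    ξ = ζ := (stream_append_inj h rfl).2

theorem take_actInf (g : G) (ξ : Stream' A) (n : ℕ) :
    (T.actInf g ξ).take n = T.act g (ξ.take n) := by
  induction n with
  | zero => simp
  | succ n ih => rw [Stream'.take_succ', Stream'.take_succ', act_append, ih]; rfl

theorem actInf_append (g : G) (l : List A) (ξ : Stream' A) :
    T.actInf g (l ++ₛ ξ) = T.act g l ++ₛ T.actInf (T.coc g l) ξ := by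
  refine Stream'.take_theorem _ _ fun n => ?_
  have key : (T.actInf g (l ++ₛ ξ)).take (l.length + n) =
      (T.act g l ++ₛ T.actInf (T.coc g l) ξ).take (l.length + n) := by
    rw [take_actInf, stream_take_append, act_append, ← length_act (T := T) g l,
      stream_take_append, take_actInf]
  have := congrArg (List.take n) key
  simpa [Stream'.take_take] using this

theorem actInf_mul (g h : G) (ξ : Stream' A) :
    T.actInf (g * h) ξ = T.actInf g (T.actInf h ξ) := by
  refine Stream'.take_theorem _ _ fun n => ?_
  rw [take_actInf, take_actInf, take_actInf, act_mul]

@[simp] theorem actInf_one (ξ : Stream' A) : T.actInf 1 ξ = ξ := by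
  refine Stream'.take_theorem _ _ fun n => ?_
  rw [take_actInf, act_one]

/-- The infinite path `g ξ`. -/
def InfPath.smul (g : G) (ξ : T.InfPath) : T.InfPath where
  seq := T.actInf g ξ.seq
  valid n := by
    have h := ξ.valid n
    change T.s (T.coc g (ξ.seq.take n) • ξ.seq n) =
      T.r (T.coc g (ξ.seq.take (n + 1)) • ξ.seq (n + 1))
    rw [T.s_smul, T.r_smul, coc_smul, coc_smul, h]

theorem InfPath.rng_smul (g : G) (ξ : T.InfPath) : (ξ.smul g).rng = g • ξ.rng :=
  T.r_smul g (ξ.seq 0)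

theorem InfPath.isPath_take (ξ : T.InfPath) (n : ℕ) :
    T.IsPath ξ.rng (ξ.seq.take n) ∧ T.endVertex ξ.rng (ξ.seq.take n) = T.r (ξ.seq n) := by
  induction n with
  | zero => exact ⟨trivial, rfl⟩
  | succ n ih =>
    rw [Stream'.take_succ', isPath_append, endVertex_append]
    exact ⟨⟨ih.1, ih.2.symm, trivial⟩, ξ.valid n⟩

/-- The initial segment of length `n` of an infinite path. -/
def InfPath.initSeg (ξ : T.InfPath) (n : ℕ) : T.FinPath :=
  ⟨ξ.rng, ξ.seq.take n, (ξ.isPath_take n).1⟩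

/-- The infinite path that remains after the first `n` edges are removed. -/
def InfPath.tail (ξ : T.InfPath) (n : ℕ) : T.InfPath :=
  ⟨ξ.seq.drop n, fun k => by
    change T.s (ξ.seq (k + n)) = T.r (ξ.seq (k + 1 + n))
    rw [ξ.valid, Nat.add_right_comm]⟩

theorem InfPath.d_initSeg (ξ : T.InfPath) (n : ℕ) : (ξ.initSeg n).d = (ξ.tail n).rng := by
  refine (ξ.isPath_take n).2.trans ?_
  change _ = T.r (ξ.seq (0 + n))
  rw [Nat.zero_add]

theorem valid_append {l : List A} {x : V} {ξ : T.InfPath} (hl : T.IsPath x l)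
    (h : T.endVertex x l = ξ.rng) :
    (∀ n, T.s ((l ++ₛ ξ.seq) n) = T.r ((l ++ₛ ξ.seq) (n + 1))) ∧ T.r ((l ++ₛ ξ.seq) 0) = x := by
  induction l generalizing x with
  | nil => exact ⟨ξ.valid, h.symm⟩
  | cons a l ih =>
    obtain ⟨h1, h2⟩ := ih hl.2 h
    refine ⟨fun n => ?_, hl.1⟩
    cases n with
    | zero => exact h2.symm
    | succ n => exact h1 n

/-- The concatenation `γ ξ` of a finite and an infinite path. -/
def FinPath.concat (γ : T.FinPath) (ξ : T.InfPath) (h : γ.d = ξ.rng) : T.InfPath :=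
  ⟨γ.edges ++ₛ ξ.seq, (valid_append γ.valid h).1⟩

theorem rng_of_append {γ : T.FinPath} {ξ η : T.InfPath} (h : γ.d = ξ.rng)
    (h' : η.seq = γ.edges ++ₛ ξ.seq) : η.rng = γ.rng := by
  rw [InfPath.rng, h']; exact (valid_append γ.valid h).2

theorem mem_cylinder {γ : T.FinPath} {η : T.InfPath} :
    η ∈ cylinder γ ↔ η.rng = γ.rng ∧ η.seq.take γ.edges.length = γ.edges := by
  constructor
  · rintro ⟨ξ, h, h'⟩
    refine ⟨rng_of_append h h', ?_⟩
    rw [h']; simpa using stream_take_append γ.edges ξ.seq 0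
  · rintro ⟨h, h'⟩
    refine ⟨η.tail γ.edges.length, ?_, ?_⟩
    · rw [← InfPath.d_initSeg, FinPath.d, FinPath.d]
      simp only [InfPath.initSeg]
      rw [h', h]
    · change η.seq = γ.edges ++ₛ Stream'.drop γ.edges.length η.seq
      have := Stream'.append_take_drop γ.edges.length η.seq
      rw [h'] at this
      exact this.symm

theorem Triple.Maps.mem_cylinder {s : T.Triple} {η μ : T.InfPath} (h : s.Maps η μ) :
    η ∈ cylinder s.β := by
  obtain ⟨ξ, h1, h2, -⟩ := h
  exact ⟨ξ, h1, h2⟩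

theorem Triple.Maps.star {s : T.Triple} {η μ : T.InfPath} (h : s.Maps η μ) :
    s.star.Maps μ η := by
  obtain ⟨ξ, h1, h2, h3⟩ := h
  refine ⟨ξ.smul s.g, ?_, h3, ?_⟩
  · rw [InfPath.rng_smul, ← h1]; exact s.d_eq
  · change η.seq = s.β.edges ++ₛ T.actInf s.g⁻¹ (T.actInf s.g ξ.seq)
    rw [← actInf_mul, inv_mul_cancel, actInf_one, h2]

theorem Triple.Maps.mem_cylinder' {s : T.Triple} {η μ : T.InfPath} (h : s.Maps η μ) :
    μ ∈ cylinder s.α := h.star.mem_cylinder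

theorem Triple.exists_maps {s : T.Triple} {η : T.InfPath} (h : η ∈ cylinder s.β) :
    ∃ μ, s.Maps η μ := by
  obtain ⟨ξ, h1, h2⟩ := h
  exact ⟨s.α.concat (ξ.smul s.g) (by rw [InfPath.rng_smul, ← h1, s.d_eq]), ξ, h1, h2, rfl⟩

theorem Triple.Maps.unique {s : T.Triple} {η μ μ' : T.InfPath} (h : s.Maps η μ)
    (h' : s.Maps η μ') : μ = μ' := by
  obtain ⟨ξ, h1, h2, h3⟩ := h
  obtain ⟨ξ', h1', h2', h3'⟩ := h'
  have : ξ.seq = ξ'.seq := stream_append_left_cancel (h2.symm.trans h2')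
  ext1
  rw [h3, h3', this]

theorem Triple.Maps.inj {s : T.Triple} {η η' μ : T.InfPath} (h : s.Maps η μ)
    (h' : s.Maps η' μ) : η = η' := h.star.unique h'.star

/-! ### Germs -/

/-- The paths and group elements that describe the germ of `s = (α, g, β)` at `η = β ξ`: if
`η|ₙ = β ε`, this is the pair consisting of `α (g ε)` and `φ(g, ε)`. -/
def Triple.lev (s : T.Triple) (η : T.InfPath) (n : ℕ) : List A × G :=
  (s.α.edges ++ T.act s.g ((η.seq.drop s.β.edges.length).take (n - s.β.edges.length)),
    T.coc s.g ((η.seq.drop s.β.edges.length).take (n - s.β.edges.length)))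

theorem Triple.lev_add {s : T.Triple} {η : T.InfPath} {ξ : Stream' A}
    (h : η.seq = s.β.edges ++ₛ ξ) (m : ℕ) :
    s.lev η (s.β.edges.length + m) =
      (s.α.edges ++ T.act s.g (ξ.take m), T.coc s.g (ξ.take m)) := by
  rw [Triple.lev, h, Stream'.drop_append_stream, Nat.add_sub_cancel_left]

theorem Triple.length_lev (s : T.Triple) (η : T.InfPath) (n : ℕ) :
    (s.lev η n).1.length = s.α.edges.length + (n - s.β.edges.length) := by
  simp [Triple.lev]

theorem Triple.tendsto_lev (s : T.Triple) (η : T.InfPath) :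
    Tendsto (fun n => (s.lev η n).1.length) atTop atTop := by
  simp only [Triple.length_lev]
  exact tendsto_atTop_mono (fun n => Nat.le_add_left _ _)
    (tendsto_sub_atTop_nat s.β.edges.length)

theorem Triple.Maps.take_eq {s : T.Triple} {η μ : T.InfPath} (h : s.Maps η μ) :
    ∀ᶠ n in atTop, μ.seq.take (s.lev η n).1.length = (s.lev η n).1 := by
  obtain ⟨ξ, h1, h2, h3⟩ := h
  filter_upwards [eventually_ge_atTop s.β.edges.length] with n hn
  obtain ⟨m, rfl⟩ := Nat.exists_eq_add_of_le hn
  rw [s.lev_add h2, h3]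
  simp only [List.length_append, length_act, Stream'.length_take]
  rw [stream_take_append, take_actInf]

theorem comparable_of_mem {β γ : T.FinPath} {μ : T.InfPath} (h : μ ∈ cylinder β)
    (h' : μ ∈ cylinder γ) : β.IsPrefix γ ∨ γ.IsPrefix β := by
  rw [mem_cylinder] at h h'
  have key : ∀ {β γ : T.FinPath}, μ.rng = β.rng ∧ μ.seq.take β.edges.length = β.edges →
      μ.rng = γ.rng ∧ μ.seq.take γ.edges.length = γ.edges →
      β.edges.length ≤ γ.edges.length → β.IsPrefix γ := by
    intro β γ h h' hl
    refine ⟨h.1.symm.trans h'.1, ?_⟩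
    rw [← h.2, ← h'.2]
    rw [← min_eq_right hl, ← Stream'.take_take]
    exact List.take_prefix _ _
  rcases le_total β.edges.length γ.edges.length with hl | hl
  · exact Or.inl (key h h' hl)
  · exact Or.inr (key h' h hl)

/-- If `t · η = μ` and `s · μ = ζ`, then `s t ≠ 0`, `(s t) · η = ζ`, and the germ of the product
is computed in the expected way. -/
theorem Triple.Maps.mul {s t : T.Triple} {η μ ζ : T.InfPath} (ht : t.Maps η μ)
    (hs : s.Maps μ ζ) :
    ∃ u : T.Triple, s.mul t = some u ∧ u.Maps η ζ ∧
      ∀ᶠ n in atTop, u.lev η n = ((s.lev μ (t.lev η n).1.length).1,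
        (s.lev μ (t.lev η n).1.length).2 * (t.lev η n).2) := by
  have hμs := hs.mem_cylinder
  have hμt := ht.mem_cylinder'
  obtain ⟨ξ, h1, h2, h3⟩ := ht
  obtain ⟨ξ', h1', h2', h3'⟩ := hs
  rw [Triple.mul]
  by_cases h : s.β.IsPrefix t.α
  · rw [dif_pos h]
    refine ⟨_, rfl, ⟨ξ, h1, h2, ?_⟩, ?_⟩
    all_goals
      have e1 : ξ'.seq = s.β.remainder t.α ++ₛ T.actInf t.g ξ.seq := by
        apply stream_append_left_cancel (l := s.β.edges)
        rw [← h2', h3, ← Stream'.append_append_stream, h.append_remainder]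
    · rw [h3', e1, actInf_append, actInf_mul]
      simp [FinPath.extend]
    · filter_upwards [eventually_ge_atTop t.β.edges.length] with n hn
      obtain ⟨m, rfl⟩ := Nat.exists_eq_add_of_le hn
      rw [t.lev_add h2, Triple.lev_add (ξ := ξ.seq) (by exact h2)]
      have e2 : (t.α.edges ++ T.act t.g (ξ.seq.take m)).length =
          s.β.edges.length + ((s.β.remainder t.α).length + m) := by
        rw [← h.append_remainder]; simp
      simp only [e2, s.lev_add h2', e1, stream_take_append, take_actInf]
      simp [FinPath.extend, act_append, coc_append, coc_mul, act_mul]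
  · rw [dif_neg h]
    have h := (comparable_of_mem hμs hμt).resolve_left h
    rw [dif_pos h]
    have e1 : T.actInf t.g ξ.seq = t.α.remainder s.β ++ₛ ξ'.seq := by
      apply stream_append_left_cancel (l := t.α.edges)
      rw [← h3, h2', ← Stream'.append_append_stream, h.append_remainder]
    have e2 : ξ.seq = T.act t.g⁻¹ (t.α.remainder s.β) ++ₛ
        T.actInf (T.coc t.g⁻¹ (t.α.remainder s.β)) ξ'.seq := by
      rw [← actInf_append, ← e1, ← actInf_mul, inv_mul_cancel, actInf_one]
    have e3 : η.seq = (t.β.edges ++ T.act t.g⁻¹ (t.α.remainder s.β)) ++ₛ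
        (ξ'.smul (T.coc t.g⁻¹ (t.α.remainder s.β))).seq := by
      rw [h2, e2, Stream'.append_append_stream]; rfl
    refine ⟨_, rfl, ⟨ξ'.smul (T.coc t.g⁻¹ (t.α.remainder s.β)), ?_, e3, ?_⟩, ?_⟩
    · have : t.β.d = t.g⁻¹ • t.α.d := by rw [t.d_eq, inv_smul_smul]
      rw [FinPath.d_extend, InfPath.rng_smul, this, endVertex_act, ← h.d_eq, coc_smul, h1']
    · rw [h3']
      simp only [InfPath.smul]
      rw [← actInf_mul, inv_mul_cancel_right]
    · filter_upwards [eventually_ge_atTop (t.β.edges.length + (t.α.remainder s.β).length)]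
        with n hn
      obtain ⟨m, rfl⟩ := Nat.exists_eq_add_of_le hn
      have e4 : (t.α.edges ++ T.act t.g (ξ.seq.take ((t.α.remainder s.β).length + m))).length =
          s.β.edges.length + m := by
        rw [← h.append_remainder]; simp [add_assoc]
      have e5 : ξ.seq.take ((t.α.remainder s.β).length + m) =
          T.act t.g⁻¹ (t.α.remainder s.β) ++
            T.act (T.coc t.g⁻¹ (t.α.remainder s.β)) (ξ'.seq.take m) := by
        rw [e2, ← length_act (T := T) t.g⁻¹ (t.α.remainder s.β), stream_take_append, take_actInf]
      have e6 := Triple.lev_add (s := ⟨s.α, s.g * (T.coc t.g⁻¹ (t.α.remainder s.β))⁻¹,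
        t.β.extend (T.act t.g⁻¹ (t.α.remainder s.β)) (by
          have : t.β.d = t.g⁻¹ • t.α.d := by rw [t.d_eq, inv_smul_smul]
          rw [this]; exact isPath_act _ h.isPath), by
          have : t.β.d = t.g⁻¹ • t.α.d := by rw [t.d_eq, inv_smul_smul]
          rw [FinPath.d_extend, s.d_eq, this, endVertex_act, mul_smul, h.d_eq,
            ← coc_smul t.g⁻¹ (t.α.remainder s.β), inv_smul_smul]⟩) e3 m
      have e7 : (t.β.edges ++ T.act t.g⁻¹ (t.α.remainder s.β)).length =
        t.β.edges.length + (t.α.remainder s.β).length := by simp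
      simp only [FinPath.extend, e7] at e6
      simp only [FinPath.extend]
      rw [e6, add_assoc, t.lev_add h2]
      simp only [e4, s.lev_add h2']
      simp only [e5, InfPath.smul, take_actInf, act_mul, act_inv_act, coc_mul, coc_inv, coc_append,
        coc_inv']

theorem idem_eq {e : T.Triple} (h : e.toSGE * e.toSGE = e.toSGE) : e.α = e.β ∧ e.g = 1 := by
  rw [toSGE_mul, Triple.mul] at h
  split_ifs at h with h1 h2
  · have h' := Option.some.inj h
    have ha := congrArg (fun t : T.Triple => t.α.edges.length) h'
    have hg := congrArg (fun t : T.Triple => t.g) h'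
    simp only [FinPath.extend, List.length_append, length_act] at ha hg
    have hε : e.β.remainder e.α = [] := List.eq_nil_of_length_eq_zero (by omega)
    have h3 := h1.append_remainder
    rw [hε, List.append_nil] at h3
    rw [hε, coc_nil] at hg
    exact ⟨FinPath.ext h1.1.symm h3.symm, by simpa using hg⟩
  · have h' := Option.some.inj h
    have ha := congrArg (fun t : T.Triple => t.β.edges.length) h'
    have hg := congrArg (fun t : T.Triple => t.g) h'
    simp only [FinPath.extend, List.length_append, length_act] at ha hg
    have hε : e.α.remainder e.β = [] := List.eq_nil_of_length_eq_zero (by omega)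
    have h3 := h2.append_remainder
    rw [hε, List.append_nil] at h3
    rw [hε, coc_nil] at hg
    exact ⟨FinPath.ext h2.1 h3, by simpa using hg⟩
  · cases h

/-- The idempotent `(γ, 1, γ)`. -/
def idem (γ : T.FinPath) : T.Triple := ⟨γ, 1, γ, (one_smul G _).symm⟩

theorem FinPath.isPrefix_self (γ : T.FinPath) : γ.IsPrefix γ := ⟨rfl, List.prefix_rfl⟩

theorem idem_mul_idem (γ : T.FinPath) : (idem γ).toSGE * (idem γ).toSGE = (idem γ).toSGE := by
  rw [toSGE_mul, Triple.mul]
  have h : (idem γ).β.IsPrefix (idem γ).α := γ.isPrefix_self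
  rw [dif_pos h]
  refine congrArg some (Triple.ext (FinPath.ext rfl ?_) ?_ rfl) <;>
  simp [idem, FinPath.extend, FinPath.remainder]

theorem idem_maps {γ : T.FinPath} {η : T.InfPath} (h : η ∈ cylinder γ) :
    (idem γ).Maps η η := by
  obtain ⟨ξ, h1, h2⟩ := h
  exact ⟨ξ, h1, h2, by rw [h2]; simp [idem]⟩

theorem lev_idem {γ : T.FinPath} {η : T.InfPath} (h : η ∈ cylinder γ) :
    ∀ᶠ n in atTop, (idem γ).lev η n = (η.seq.take n, 1) := by
  obtain ⟨ξ, h1, h2⟩ := h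
  filter_upwards [eventually_ge_atTop γ.edges.length] with n hn
  obtain ⟨m, rfl⟩ := Nat.exists_eq_add_of_le hn
  have := Triple.lev_add (s := idem γ) h2 m
  simp only [idem] at this
  rw [idem, this, h2, stream_take_append]
  simp

theorem InfPath.mem_cylinder_initSeg (η : T.InfPath) (n : ℕ) : η ∈ cylinder (η.initSeg n) := by
  rw [GraphTriple.mem_cylinder]
  exact ⟨rfl, by simp [InfPath.initSeg]⟩

theorem mul_idem_lev {s : T.Triple} {η μ : T.InfPath} (hs : s.Maps η μ) {γ : T.FinPath}
    (h : η ∈ cylinder γ) :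
    ∃ u : T.Triple, s.toSGE * (idem γ).toSGE = u.toSGE ∧ ∀ᶠ n in atTop, u.lev η n = s.lev η n := by
  obtain ⟨u, hu, -, hl⟩ := (idem_maps h).mul hs
  refine ⟨u, hu, ?_⟩
  filter_upwards [hl, lev_idem h] with n h1 h2
  rw [h1, h2]
  simp

theorem mul_idem_initSeg {s : T.Triple} {η μ : T.InfPath} (hs : s.Maps η μ) {n : ℕ}
    (hn : s.β.edges.length ≤ n) :
    ∃ h h', s.toSGE * (idem (η.initSeg n)).toSGE =
      Triple.toSGE ⟨⟨s.α.rng, (s.lev η n).1, h⟩, (s.lev η n).2, η.initSeg n, h'⟩ := by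
  have hp : s.β.IsPrefix (idem (η.initSeg n)).α := by
    refine (comparable_of_mem hs.mem_cylinder (η.mem_cylinder_initSeg n)).elim id fun h => ⟨h.1.symm, ?_⟩
    have h1 := h.2
    have h2 : (η.initSeg n).edges = s.β.edges := h1.eq_of_length_le (by simpa [InfPath.initSeg])
    exact h2 ▸ List.prefix_rfl
  obtain ⟨ξ, h1, h2, h3⟩ := hs
  obtain ⟨m, rfl⟩ := Nat.exists_eq_add_of_le hn
  have hr : s.β.remainder (idem (η.initSeg (s.β.edges.length + m))).α = ξ.seq.take m := by
    simp [FinPath.remainder, idem, InfPath.initSeg, h2, stream_take_append]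
  rw [toSGE_mul, Triple.mul, dif_pos hp]
  have e1 := s.lev_add h2 m
  have key : ∀ (u : T.Triple), u.α.rng = s.α.rng → u.α.edges =
      (s.lev η (s.β.edges.length + m)).1 → u.g = (s.lev η (s.β.edges.length + m)).2 →
      u.β = η.initSeg (s.β.edges.length + m) → ∃ h h', some u =
      Triple.toSGE ⟨⟨s.α.rng, (s.lev η (s.β.edges.length + m)).1, h⟩,
        (s.lev η (s.β.edges.length + m)).2, η.initSeg (s.β.edges.length + m), h'⟩ := by
    rintro ⟨⟨x, l, hl⟩, g, β, hd⟩ h1 h2 h3 h4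
    dsimp only at h1 h2 h3 h4
    subst h1 h2 h3 h4
    exact ⟨hl, hd, rfl⟩
  apply key
  · rfl
  · rw [e1]; simp only [FinPath.extend, hr]
  · rw [e1]; simp only [idem] at hr; simp [idem, hr]
  · rfl

theorem germRel_iff {s t : T.Triple} {η μ ζ : T.InfPath} (hs : s.Maps η μ) (ht : t.Maps η ζ) :
    GermRel η s t ↔ ∀ᶠ n in atTop, s.lev η n = t.lev η n := by
  constructor
  · rintro ⟨e, he, hm, hst⟩
    obtain ⟨h1, h2⟩ := idem_eq he
    have he' : e = idem e.β := Triple.ext h1 h2 rfl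
    rw [he'] at hst
    obtain ⟨u, hu, hlu⟩ := mul_idem_lev hs hm.mem_cylinder
    obtain ⟨v, hv, hlv⟩ := mul_idem_lev ht hm.mem_cylinder
    have huv : u = v := Option.some.inj ((hu.symm.trans hst).trans hv)
    filter_upwards [hlu, hlv] with n h3 h4
    rw [← h3, huv, h4]
  · intro h
    obtain ⟨n, hn, hs1, ht1⟩ := (h.and ((eventually_ge_atTop (s.β.edges.length + 1)).and
      (eventually_ge_atTop (t.β.edges.length + 1)))).exists
    refine ⟨idem (η.initSeg n), idem_mul_idem _, idem_maps (η.mem_cylinder_initSeg n), ?_⟩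
    obtain ⟨a, b, e1⟩ := mul_idem_initSeg hs (n := n) (by omega)
    obtain ⟨c, d, e2⟩ := mul_idem_initSeg ht (n := n) (by omega)
    rw [e1, e2]
    refine congrArg some (Triple.ext (FinPath.ext ?_ (congrArg Prod.fst hn))
      (congrArg Prod.snd hn) rfl)
    have c' := c
    rw [← hn] at c'
    refine a.unique c' fun h0 => ?_
    have := congrArg List.length h0
    rw [Triple.length_lev, List.length_nil] at this
    omega

/-- Elements with the same germ at `η` map `η` to the same path. -/
theorem GermRel.eq_of_maps {s t : T.Triple} {η μ ζ : T.InfPath} (h : GermRel η s t)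
    (hs : s.Maps η μ) (ht : t.Maps η ζ) : μ = ζ := by
  rw [germRel_iff hs ht] at h
  have hev := (h.and (hs.take_eq.and ht.take_eq))
  ext1
  refine Stream'.take_theorem _ _ fun k => ?_
  obtain ⟨n, ⟨h1, h2, h3⟩, h4⟩ :=
    (hev.and ((s.tendsto_lev η).eventually_ge_atTop k)).exists
  have : μ.seq.take (s.lev η n).1.length = ζ.seq.take (s.lev η n).1.length := by
    rw [h2, h1, h3]
  have := congrArg (List.take k) this
  rwa [Stream'.take_take, Stream'.take_take, min_eq_right h4] at this

theorem Triple.eventually_of_lev (s : T.Triple) (η : T.InfPath) {p : ℕ → Prop}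
    (h : ∀ᶠ n in atTop, p (s.lev η n).1.length) : ∀ᶠ n in atTop, p n := by
  obtain ⟨N, hN⟩ := eventually_atTop.1 h
  filter_upwards [eventually_ge_atTop (s.α.edges.length + N)] with m hm
  have := hN (m - s.α.edges.length + s.β.edges.length) (by omega)
  rw [Triple.length_lev] at this
  convert this using 1
  omega

theorem Triple.Maps.lev_star {s : T.Triple} {η μ : T.InfPath} (h : s.Maps η μ) :
    ∀ᶠ n in atTop, s.star.lev μ (s.lev η n).1.length =
      (η.seq.take n, (s.lev η n).2⁻¹) := by
  obtain ⟨ξ, h1, h2, h3⟩ := h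
  filter_upwards [eventually_ge_atTop s.β.edges.length] with n hn
  obtain ⟨m, rfl⟩ := Nat.exists_eq_add_of_le hn
  have e := s.star.lev_add (η := μ) h3 m
  rw [s.lev_add h2]
  simp only [List.length_append, length_act, Stream'.length_take]
  simp only [Triple.star] at e ⊢
  rw [e, take_actInf, act_inv_act, coc_inv, h2, stream_take_append]

theorem GermRel.star {s t : T.Triple} {η μ : T.InfPath} (h : GermRel η s t)
    (hs : s.Maps η μ) (ht : t.Maps η μ) : GermRel μ s.star t.star := by
  rw [germRel_iff hs ht] at h
  rw [germRel_iff hs.star ht.star]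
  apply s.eventually_of_lev η
  filter_upwards [h, hs.lev_star, ht.lev_star] with n h1 h2 h3
  rw [h2, h1, h3]

/-! ### The groupoid of germs -/

/-- Equality of germs `[s; η] = [t; η]`, for those `s`, `t` that map `η` to `μ`. -/
def germSetoid (η μ : T.InfPath) : Setoid {s : T.Triple // s.Maps η μ} where
  r s t := GermRel η s.1 t.1
  iseqv := by
    refine ⟨fun s => (germRel_iff s.2 s.2).2 (by simp), fun {s t} h => ?_, fun {s t u} h h' => ?_⟩
    · rw [germRel_iff s.2 t.2] at h
      exact (germRel_iff t.2 s.2).2 (h.mono fun _ => Eq.symm)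
    · rw [germRel_iff s.2 t.2] at h
      rw [germRel_iff t.2 u.2] at h'
      exact (germRel_iff s.2 u.2).2 ((h.and h').mono fun _ h => h.1.trans h.2)

/-- The germs `[s; η]` with source `η` and range `s · η = μ`. -/
def GermHom (η μ : T.InfPath) := Quotient (germSetoid η μ)

/-- The germ `[s; η]`, as an arrow from `η` to `s · η = μ`. -/
def germ {η μ : T.InfPath} (s : T.Triple) (h : s.Maps η μ) : GermHom η μ :=
  Quotient.mk (germSetoid η μ) ⟨s, h⟩

theorem germ_eq_iff {η μ : T.InfPath} {s t : T.Triple} (hs : s.Maps η μ) (ht : t.Maps η μ) :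
    germ s hs = germ t ht ↔ GermRel η s t :=
  Quotient.eq (r := germSetoid η μ)

theorem germ_eq_iff_lev {η μ : T.InfPath} {s t : T.Triple} (hs : s.Maps η μ)
    (ht : t.Maps η μ) :
    germ s hs = germ t ht ↔ ∀ᶠ n in atTop, s.lev η n = t.lev η n := by
  rw [germ_eq_iff, germRel_iff hs ht]

/-- The nonzero product `s t`, when `t · η = μ` and `s · μ = ζ`. -/
noncomputable def mulOf {s t : T.Triple} {η μ ζ : T.InfPath} (ht : t.Maps η μ)
    (hs : s.Maps μ ζ) : T.Triple :=
  (s.mul t).get (by obtain ⟨u, hu, -⟩ := ht.mul hs; rw [hu]; rfl)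

theorem toSGE_mulOf {s t : T.Triple} {η μ ζ : T.InfPath} (ht : t.Maps η μ)
    (hs : s.Maps μ ζ) : (mulOf ht hs).toSGE = s.toSGE * t.toSGE :=
  Option.some_get _

theorem mulOf_spec {s t : T.Triple} {η μ ζ : T.InfPath} (ht : t.Maps η μ)
    (hs : s.Maps μ ζ) : (mulOf ht hs).Maps η ζ ∧
      ∀ᶠ n in atTop, (mulOf ht hs).lev η n = ((s.lev μ (t.lev η n).1.length).1,
        (s.lev μ (t.lev η n).1.length).2 * (t.lev η n).2) := by
  obtain ⟨u, hu, h⟩ := ht.mul hs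
  have : mulOf ht hs = u := by
    have := toSGE_mulOf ht hs
    rw [toSGE_mul, hu] at this
    exact Option.some.inj this
  rw [this]; exact h

/-- Composition of germs, `[s; t · η] [t; η] = [s t; η]`. -/
noncomputable def germComp {η μ ζ : T.InfPath} (b : GermHom η μ) (a : GermHom μ ζ) :
    GermHom η ζ :=
  Quotient.liftOn₂ (s₁ := germSetoid η μ) (s₂ := germSetoid μ ζ) b a
    (fun t s => germ (mulOf t.2 s.2) (mulOf_spec t.2 s.2).1) (by
      intro t s t' s' ht hs
      have ht := (germRel_iff t.2 t'.2).1 ht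
      have hs := (germRel_iff s.2 s'.2).1 hs
      rw [germ_eq_iff_lev]
      filter_upwards [ht, (t.1.tendsto_lev η).eventually hs, (mulOf_spec t.2 s.2).2,
        (mulOf_spec t'.2 s'.2).2] with n h1 h2 h3 h4
      rw [h3, h4, h2, h1])

theorem germComp_germ {η μ ζ : T.InfPath} {s t : T.Triple} (ht : t.Maps η μ)
    (hs : s.Maps μ ζ) :
    germComp (germ t ht) (germ s hs) = germ (mulOf ht hs) (mulOf_spec ht hs).1 := rfl

/-- The inverse of a germ, `[s; η]⁻¹ = [s*; s · η]`. -/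
def germInv {η μ : T.InfPath} (a : GermHom η μ) : GermHom μ η :=
  Quotient.liftOn (s := germSetoid η μ) a (fun s => germ s.1.star s.2.star) (by
    intro s t hst
    rw [germ_eq_iff]
    exact GermRel.star hst s.2 t.2)

theorem exists_germ {η μ : T.InfPath} (a : GermHom η μ) :
    ∃ (s : T.Triple) (h : s.Maps η μ), a = germ s h := by
  refine Quotient.inductionOn (s := germSetoid η μ) a fun s => ⟨s.1, s.2, rfl⟩

/-- The germ `[x, 1, x; η]` with `x` the range of `η`. -/
def germOne (η : T.InfPath) : GermHom η η :=
  germ (idem (η.initSeg 0)) (idem_maps (η.mem_cylinder_initSeg 0))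

theorem germComp_germ_eq_iff {η μ ζ : T.InfPath} {s t u : T.Triple} (ht : t.Maps η μ)
    (hs : s.Maps μ ζ) (hu : u.Maps η ζ) :
    germComp (germ t ht) (germ s hs) = germ u hu ↔
      ∀ᶠ n in atTop, u.lev η n = ((s.lev μ (t.lev η n).1.length).1,
        (s.lev μ (t.lev η n).1.length).2 * (t.lev η n).2) := by
  rw [germComp_germ, germ_eq_iff_lev]
  have h := (mulOf_spec ht hs).2
  constructor
  · intro h'
    filter_upwards [h, h'] with n h1 h2
    rw [← h2, h1]
  · intro h'
    filter_upwards [h, h'] with n h1 h2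
    rw [h2, h1]

/-- The groupoid of germs of the action of the inverse semigroup of `(G, E, φ)` on the space of
infinite paths. The objects (units) are the infinite paths, and an arrow `[s; η]` goes from its
source `η` to its range `s · η`. In the diagrammatic notation of category theory, the product
`a b` of the groupoid elements `a` and `b` is the composition `b ≫ a`. -/
noncomputable instance : Groupoid T.InfPath where
  Hom η μ := GermHom η μ
  id η := germOne η
  comp b a := germComp b a
  inv a := germInv a
  id_comp {η μ} a := by
    obtain ⟨s, hs, rfl⟩ := exists_germ a
    refine (germComp_germ_eq_iff _ _ _).2 ?_
    filter_upwards [lev_idem (InfPath.mem_cylinder_initSeg η 0)] with n h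
    rw [h]; simp
  comp_id {η μ} a := by
    obtain ⟨s, hs, rfl⟩ := exists_germ a
    refine (germComp_germ_eq_iff _ _ _).2 ?_
    filter_upwards [(s.tendsto_lev _).eventually (lev_idem (InfPath.mem_cylinder_initSeg μ 0)),
      hs.take_eq] with n h h'
    rw [h]; simp [h']
  assoc {η _ _ _} c b a := by
    obtain ⟨u, hu, rfl⟩ := exists_germ c
    obtain ⟨t, ht, rfl⟩ := exists_germ b
    obtain ⟨s, hs, rfl⟩ := exists_germ a
    rw [germComp_germ hu ht, germComp_germ ht hs, germComp_germ, eq_comm, germComp_germ_eq_iff]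
    filter_upwards [(mulOf_spec (mulOf_spec hu ht).1 hs).2, (mulOf_spec hu ht).2,
      (u.tendsto_lev η).eventually (mulOf_spec ht hs).2] with n h1 h2 h3
    rw [h1, h2]
    simp [h3, mul_assoc]
  inv_comp {η μ} a := by
    obtain ⟨s, hs, rfl⟩ := exists_germ a
    refine (germComp_germ_eq_iff _ _ _).2 ?_
    apply s.eventually_of_lev
    filter_upwards [hs.lev_star, hs.take_eq, (s.tendsto_lev _).eventually
      (lev_idem (InfPath.mem_cylinder_initSeg μ 0))] with n h1 h2 h3
    rw [h1, h3]; simp [h2]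
  comp_inv {η μ} a := by
    obtain ⟨s, hs, rfl⟩ := exists_germ a
    refine (germComp_germ_eq_iff _ _ _).2 ?_
    filter_upwards [hs.lev_star, lev_idem (InfPath.mem_cylinder_initSeg η 0)] with n h1 h2
    rw [h1, h2]; simp

end GraphTriple

/-! ### Steinberg algebras -/

section Steinberg

variable {X : Type*} [Groupoid X]

/-- A bisection of a groupoid: a set of arrows on which the source map and the range map are
injective. -/
def IsBisection (B : Set (Quiver.Total X)) : Prop :=
  Set.InjOn Quiver.Total.left B ∧ Set.InjOn Quiver.Total.right B

/-- The product `B D` of two sets of arrows. -/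
def setMul (B D : Set (Quiver.Total X)) : Set (Quiver.Total X) :=
  {c | ∃ (y : X) (d : c.left ⟶ y) (b : y ⟶ c.right), d ≫ b = c.hom ∧
    (⟨y, c.right, b⟩ : Quiver.Total X) ∈ B ∧ (⟨c.left, y, d⟩ : Quiver.Total X) ∈ D}

/-- The factorizations `c = b d` of an arrow `c` of a groupoid: composable pairs `(b, d)` with
product `c`. In diagrammatic notation, the product `b d` is `d ≫ b`. -/
@[ext] structure Factorization (c : Quiver.Total X) where
  mid : X
  d : c.left ⟶ mid
  b : mid ⟶ c.right
  comp_eq : d ≫ b = c.hom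

/-- The first factor `b` of a factorization `c = b d`. -/
def Factorization.fst {c : Quiver.Total X} (p : Factorization c) : Quiver.Total X :=
  ⟨p.mid, c.right, p.b⟩

/-- The second factor `d` of a factorization `c = b d`. -/
def Factorization.snd {c : Quiver.Total X} (p : Factorization c) : Quiver.Total X :=
  ⟨c.left, p.mid, p.d⟩

/-- The convolution product of two functions on a groupoid: the value at `c` is the sum of
`f b * g d` over all composable pairs `(b, d)` with product `c`. -/
noncomputable def conv {R : Type*} [CommRing R] (f g : Quiver.Total X → R) :
    Quiver.Total X → R :=
  fun c => ∑ᶠ p : Factorization c, f p.fst * g p.snd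

/-- The underlying module of the Steinberg algebra: the span of the characteristic functions of
compact open bisections. -/
def steinbergModule (R X : Type*) [CommRing R] [Groupoid X]
    [TopologicalSpace (Quiver.Total X)] : Submodule R (Quiver.Total X → R) :=
  Submodule.span R {f | ∃ B : Set (Quiver.Total X), IsOpen B ∧ IsCompact B ∧ IsBisection B ∧
    f = B.indicator 1}

/-- The Steinberg algebra `A_R(𝒢)` of an ample groupoid `𝒢` with unit space `X` and arrow space
`Quiver.Total X`. -/
def SteinbergAlgebra (R X : Type*) [CommRing R] [Groupoid X]
    [TopologicalSpace (Quiver.Total X)] : Type _ :=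
  ↥(steinbergModule R X)

variable {R : Type*} [CommRing R]

theorem Factorization.snd_injective {c : Quiver.Total X} :
    Function.Injective (Factorization.snd (c := c)) := by
  rintro ⟨y, d, b, h⟩ ⟨y', d', b', h'⟩ e
  simp only [Factorization.snd, Quiver.Total.mk.injEq, true_and] at e
  obtain ⟨rfl, e⟩ := e
  obtain rfl := eq_of_heq e
  obtain rfl := (cancel_epi d).1 (h.trans h'.symm)
  rfl

theorem mem_setMul {B D : Set (Quiver.Total X)} {c : Quiver.Total X} :
    c ∈ setMul B D ↔ ∃ p : Factorization c, p.fst ∈ B ∧ p.snd ∈ D :=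
  ⟨fun ⟨y, d, b, h, hb, hd⟩ => ⟨⟨y, d, b, h⟩, hb, hd⟩,
    fun ⟨⟨y, d, b, h⟩, hb, hd⟩ => ⟨y, d, b, h, hb, hd⟩⟩

/-- Functions with finitely many nonzero values on the arrows with a given source. -/
def SourceFinite (f : Quiver.Total X → R) : Prop :=
  ∀ x : X, {c : Quiver.Total X | c.left = x ∧ f c ≠ 0}.Finite

theorem SourceFinite.finite_support {f g : Quiver.Total X → R} (hg : SourceFinite g)
    (c : Quiver.Total X) :
    (Function.support fun p : Factorization c => f p.fst * g p.snd).Finite := by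
  refine Set.Finite.of_finite_image ((hg c.left).subset ?_) Factorization.snd_injective.injOn
  rintro _ ⟨p, hp, rfl⟩
  exact ⟨rfl, right_ne_zero_of_mul hp⟩

theorem conv_add_left {f f' g : Quiver.Total X → R} (hg : SourceFinite g) :
    conv (f + f') g = conv f g + conv f' g := by
  funext c
  simp only [conv, Pi.add_apply, add_mul]
  exact finsum_add_distrib (hg.finite_support c) (hg.finite_support c)

theorem conv_add_right {f g g' : Quiver.Total X → R} (hg : SourceFinite g)
    (hg' : SourceFinite g') : conv f (g + g') = conv f g + conv f g' := by
  funext c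
  simp only [conv, Pi.add_apply, mul_add]
  exact finsum_add_distrib (hg.finite_support c) (hg'.finite_support c)

theorem conv_smul_left {f g : Quiver.Total X → R} (r : R) (hg : SourceFinite g) :
    conv (r • f) g = r • conv f g := by
  funext c
  simp only [conv, Pi.smul_apply, smul_eq_mul, mul_assoc]
  exact (mul_finsum' _ r (hg.finite_support c)).symm

theorem conv_smul_right {f g : Quiver.Total X → R} (r : R) (hg : SourceFinite g) :
    conv f (r • g) = r • conv f g := by
  funext c
  simp only [conv, Pi.smul_apply, smul_eq_mul, mul_left_comm]
  exact (mul_finsum' _ r (hg.finite_support c)).symm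

@[simp] theorem conv_zero_left (g : Quiver.Total X → R) : conv 0 g = 0 := by
  funext c; simp [conv]

@[simp] theorem conv_zero_right (f : Quiver.Total X → R) : conv f 0 = 0 := by
  funext c; simp [conv]

theorem conv_indicator {B D : Set (Quiver.Total X)} (hD : IsBisection D) :
    conv (B.indicator (1 : Quiver.Total X → R)) (D.indicator 1) = (setMul B D).indicator 1 := by
  classical
  funext c
  by_cases hc : c ∈ setMul B D
  · obtain ⟨p, hb, hd⟩ := mem_setMul.1 hc
    rw [Set.indicator_of_mem hc, conv, finsum_eq_single _ p]
    · simp [hb, hd]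
    · intro q hq
      have : q.snd ∉ D := fun h => hq (Factorization.snd_injective (hD.1 h hd rfl))
      simp [this]
  · rw [Set.indicator_of_notMem hc, conv]
    refine finsum_eq_zero_of_forall_eq_zero fun p => ?_
    by_contra h
    refine hc (mem_setMul.2 ⟨p, ?_, ?_⟩)
    · by_contra h'; simp [h'] at h
    · by_contra h'; simp [h'] at h

theorem IsBisection.setMul {B D : Set (Quiver.Total X)} (hB : IsBisection B)
    (hD : IsBisection D) : IsBisection (setMul B D) := by
  constructor
  · rintro ⟨x, z, c⟩ ⟨y, d, b, h, hb, hd⟩ ⟨x', z', c'⟩ ⟨y', d', b', h', hb', hd'⟩ e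
    dsimp only at d b h hb hd d' b' h' hb' hd' e
    subst e
    have e1 := hD.1 hd hd' rfl
    simp only [Quiver.Total.mk.injEq, true_and] at e1
    obtain ⟨rfl, e1⟩ := e1
    obtain rfl := eq_of_heq e1
    have e2 := hB.1 hb hb' rfl
    simp only [Quiver.Total.mk.injEq, true_and] at e2
    obtain ⟨rfl, e2⟩ := e2
    obtain rfl := eq_of_heq e2
    rw [← h, ← h']
  · rintro ⟨x, z, c⟩ ⟨y, d, b, h, hb, hd⟩ ⟨x', z', c'⟩ ⟨y', d', b', h', hb', hd'⟩ e
    dsimp only at d b h hb hd d' b' h' hb' hd' e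
    subst e
    have e1 := hB.2 hb hb' rfl
    simp only [Quiver.Total.mk.injEq, true_and] at e1
    obtain ⟨rfl, e1⟩ := e1
    obtain rfl := eq_of_heq e1
    have e2 := hD.2 hd hd' rfl
    simp only [Quiver.Total.mk.injEq] at e2
    obtain ⟨rfl, -, e2⟩ := e2
    obtain rfl := eq_of_heq e2
    rw [← h, ← h']

theorem setMul_assoc (B C D : Set (Quiver.Total X)) :
    setMul (setMul B C) D = setMul B (setMul C D) := by
  ext ⟨x, w, a⟩
  constructor
  · rintro ⟨y, d, e, h, ⟨z, c, b, h', hb, hc⟩, hd⟩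
    dsimp only at d e h c b h' hb hc hd
    exact ⟨z, d ≫ c, b, by rw [Category.assoc, h', h], hb, y, d, c, rfl, hc, hd⟩
  · rintro ⟨y, e, b, h, hb, ⟨z, d, c, h', hc, hd⟩⟩
    dsimp only at e b h hb c d h' hc hd
    exact ⟨z, d, c ≫ b, by rw [← Category.assoc, h', h], ⟨y, c, b, rfl, hb, hc⟩, hd⟩

/-- The unit space, as a set of arrows. -/
def unitArrows (X : Type*) [Groupoid X] : Set (Quiver.Total X) :=
  Set.range fun x => ⟨x, x, 𝟙 x⟩

theorem isBisection_unitArrows : IsBisection (unitArrows X) := by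
  constructor <;>
  · rintro _ ⟨x, rfl⟩ _ ⟨y, rfl⟩ (h : x = y)
    rw [h]

theorem unitArrows_setMul (B : Set (Quiver.Total X)) : setMul (unitArrows X) B = B := by
  ext ⟨x, w, a⟩
  constructor
  · rintro ⟨y, d, e, h, ⟨z, hz⟩, hd⟩
    simp only [Quiver.Total.mk.injEq] at hz
    obtain ⟨rfl, rfl, hz⟩ := hz
    obtain rfl := eq_of_heq hz
    dsimp only at d h hd
    rw [← h]; simpa using hd
  · exact fun h => ⟨w, a, 𝟙 w, Category.comp_id a, ⟨w, rfl⟩, h⟩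

theorem setMul_unitArrows (B : Set (Quiver.Total X)) : setMul B (unitArrows X) = B := by
  ext ⟨x, w, a⟩
  constructor
  · rintro ⟨y, d, e, h, hd, ⟨z, hz⟩⟩
    simp only [Quiver.Total.mk.injEq] at hz
    obtain ⟨rfl, rfl, hz⟩ := hz
    obtain rfl := eq_of_heq hz
    dsimp only at e h hd
    rw [← h]; simpa using hd
  · exact fun h => ⟨x, 𝟙 x, a, Category.id_comp a, h, ⟨x, rfl⟩⟩

variable [TopologicalSpace (Quiver.Total X)]

theorem sourceFinite_of_mem {f : Quiver.Total X → R} (hf : f ∈ steinbergModule R X) :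
    SourceFinite f := by
  classical
  induction hf using Submodule.span_induction with
  | mem f hf =>
    obtain ⟨B, -, -, hB, rfl⟩ := hf
    intro x
    refine Set.Subsingleton.finite ?_
    rintro a ⟨ha, ha'⟩ b ⟨hb, hb'⟩
    exact hB.1 (Set.mem_of_indicator_ne_zero ha') (Set.mem_of_indicator_ne_zero hb')
      (ha.trans hb.symm)
  | zero => intro x; simp
  | add f g _ _ hf hg =>
    intro x
    refine ((hf x).union (hg x)).subset ?_
    rintro a ⟨ha, ha'⟩
    by_cases h : f a = 0
    · exact Or.inr ⟨ha, fun h' => ha' (by simp [h, h'])⟩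
    · exact Or.inl ⟨ha, h⟩
  | smul r f _ hf =>
    intro x
    refine (hf x).subset ?_
    rintro a ⟨ha, ha'⟩
    exact ⟨ha, fun h => ha' (by simp [h])⟩

end Steinberg

namespace GraphTriple
variable {T : GraphTriple G V A}

/-! ### The topology of the groupoid of germs -/

/-- The infinite path space carries the topology inherited from the product of copies of the
discrete space of edges. -/
instance : TopologicalSpace T.InfPath :=
  TopologicalSpace.induced InfPath.seq (@Pi.topologicalSpace ℕ (fun _ => A) fun _ => ⊥)

/-- `Θ(s; Z(γ))`: the set of all germs `[s; ξ]` with `ξ ∈ Z(γ)`. -/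
def Theta (s : T.Triple) (γ : T.FinPath) : Set (Quiver.Total T.InfPath) :=
  {a | a.left ∈ cylinder γ ∧ ∃ h : s.Maps a.left a.right, a.hom = germ s h}

/-- The topology of the groupoid of germs, with the sets `Θ(s; Z(γ))` as a basis. -/
instance : TopologicalSpace (Quiver.Total T.InfPath) :=
  TopologicalSpace.generateFrom
    {U | ∃ (s : T.Triple) (γ : T.FinPath), U = Theta s γ}

theorem isOpen_of_take {S : Set T.InfPath} (N : ℕ)
    (h : ∀ η ∈ S, ∀ ξ : T.InfPath, (∀ k < N, ξ.seq k = η.seq k) → ξ ∈ S) : IsOpen S := by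
  let _ : TopologicalSpace A := ⊥
  have _ : DiscreteTopology A := ⟨rfl⟩
  have hc : ∀ k, Continuous fun ξ : T.InfPath => ξ.seq k := fun k =>
    (continuous_apply k).comp (continuous_induced_dom (f := InfPath.seq (T := T)))
  rw [isOpen_iff_mem_nhds]
  intro η hη
  have : IsOpen (⋂ k ∈ Finset.range N, (fun ξ : T.InfPath => ξ.seq k) ⁻¹' {η.seq k}) :=
    isOpen_biInter_finset fun k _ => (isOpen_discrete _).preimage (hc k)
  refine mem_of_superset (this.mem_nhds (by simp)) fun ξ hξ => h η hη ξ fun k hk => ?_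
  simp only [Finset.mem_range, Set.mem_iInter] at hξ
  exact hξ k hk

theorem stream_take_congr {ξ η : Stream' A} {N : ℕ} (h : ∀ k < N, ξ k = η k) :
    ξ.take N = η.take N := by
  induction N with
  | zero => rfl
  | succ n ih =>
    rw [Stream'.take_succ', Stream'.take_succ', ih fun k hk => h k (by omega)]
    exact congrArg _ (congrArg (fun a => [a]) (h n (by omega)))

theorem cylinder_congr {γ : T.FinPath} {ξ η : T.InfPath}
    (h : ∀ k < γ.edges.length + 1, ξ.seq k = η.seq k) : ξ ∈ cylinder γ ↔ η ∈ cylinder γ := by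
  rw [mem_cylinder, mem_cylinder, InfPath.rng, InfPath.rng, h 0 (by omega),
    stream_take_congr fun k hk => h k (by omega)]

theorem isOpen_cylinder (γ : T.FinPath) : IsOpen (cylinder γ) :=
  isOpen_of_take (γ.edges.length + 1) fun _ hη _ h => (cylinder_congr h).2 hη

theorem isClosed_cylinder (γ : T.FinPath) : IsClosed (cylinder γ) :=
  ⟨isOpen_of_take (γ.edges.length + 1) fun _ hη _ h h' => hη ((cylinder_congr h).1 h')⟩

instance [Finite A] : CompactSpace T.InfPath := by
  let _ : TopologicalSpace A := ⊥
  have _ : DiscreteTopology A := ⟨rfl⟩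
  let f : T.InfPath → (ℕ → A) := InfPath.seq
  have hr : Set.range f = {x : ℕ → A | ∀ n, T.s (x n) = T.r (x (n + 1))} := by
    ext x
    exact ⟨fun ⟨ξ, h⟩ => h ▸ ξ.valid, fun h => ⟨⟨x, h⟩, rfl⟩⟩
  have hcl : IsClosed (Set.range f) := by
    rw [hr, Set.ofPred_forall]
    refine isClosed_iInter fun n => ?_
    have : Continuous fun x : ℕ → A => (x n, x (n + 1)) := by fun_prop
    exact (isClosed_discrete {p : A × A | T.s p.1 = T.r p.2}).preimage this
  have he : Topology.IsClosedEmbedding f :=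
    ⟨⟨⟨rfl⟩, fun ξ η h => InfPath.ext h⟩, hcl⟩
  exact he.compactSpace

theorem cylinder_initSeg_subset {γ : T.FinPath} {η : T.InfPath} (h : η ∈ cylinder γ) {n : ℕ}
    (hn : γ.edges.length ≤ n) : cylinder (η.initSeg n) ⊆ cylinder γ := by
  intro ξ hξ
  rw [mem_cylinder] at h hξ ⊢
  refine ⟨hξ.1.trans h.1, ?_⟩
  have h2 := congrArg (List.take γ.edges.length) hξ.2
  simp only [InfPath.initSeg, Stream'.length_take, Stream'.take_take] at h2
  rw [min_eq_right hn, h.2] at h2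
  exact h2

theorem isOpen_Theta (s : T.Triple) (γ : T.FinPath) : IsOpen (Theta s γ) :=
  TopologicalSpace.isOpen_generateFrom_of_mem ⟨s, γ, rfl⟩

theorem Theta_isBisection (s : T.Triple) (γ : T.FinPath) : IsBisection (Theta s γ) := by
  constructor
  · rintro ⟨x, y, a⟩ ⟨-, h, e⟩ ⟨x', y', a'⟩ ⟨-, h', e'⟩ hx
    dsimp only at h e h' e' hx
    subst hx
    obtain rfl := h.unique h'
    rw [e, e']
  · rintro ⟨x, y, a⟩ ⟨-, h, e⟩ ⟨x', y', a'⟩ ⟨-, h', e'⟩ hx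
    dsimp only at h e h' e' hx
    subst hx
    obtain rfl := h.inj h'
    rw [e, e']

/-- If `s` and `t` have the same germ at `η`, they do so at all nearby points. -/
theorem GermRel.exists_cylinder {s t : T.Triple} {η : T.InfPath} (h : GermRel η s t) :
    ∃ γ : T.FinPath, η ∈ cylinder γ ∧ ∀ ξ ∈ cylinder γ, GermRel ξ s t := by
  obtain ⟨e, he, hm, hst⟩ := h
  refine ⟨e.β, hm.mem_cylinder, fun ξ hξ => ⟨e, he, ?_, hst⟩⟩
  have h' : e = idem e.β := Triple.ext (idem_eq he).1 (idem_eq he).2 rfl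
  rw [h']; exact idem_maps hξ

theorem exists_Theta_subset {U : Set (Quiver.Total T.InfPath)} (hU : IsOpen U)
    {a : Quiver.Total T.InfPath} (ha : a ∈ U) {s : T.Triple} (hs : s.Maps a.left a.right)
    (e : a.hom = germ s hs) : ∀ᶠ n in atTop, Theta s (a.left.initSeg n) ⊆ U := by
  induction hU with
  | basic U hU =>
    obtain ⟨t, γ, rfl⟩ := hU
    obtain ⟨hγ, ht, e'⟩ := ha
    have hst := (germ_eq_iff hs ht).1 (e.symm.trans e')
    obtain ⟨δ, hδ, H⟩ := hst.exists_cylinder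
    filter_upwards [eventually_ge_atTop γ.edges.length, eventually_ge_atTop δ.edges.length,
      eventually_ge_atTop t.β.edges.length] with n h1 h2 h3
    rintro ⟨x, y, b⟩ ⟨hx, hsx, eb⟩
    dsimp only at hx hsx eb
    obtain ⟨ζ, htx⟩ := Triple.exists_maps (cylinder_initSeg_subset ht.mem_cylinder h3 hx)
    have hr := H x (cylinder_initSeg_subset hδ h2 hx)
    obtain rfl := hr.eq_of_maps hsx htx
    exact ⟨cylinder_initSeg_subset hγ h1 hx, htx, eb.trans ((germ_eq_iff hsx htx).2 hr)⟩
  | univ => exact Eventually.of_forall fun n => Set.subset_univ _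
  | inter U W _ _ h1 h2 =>
    filter_upwards [h1 ha.1, h2 ha.2] with n h h' using Set.subset_inter h h'
  | sUnion S _ h =>
    obtain ⟨U, hU, haU⟩ := ha
    filter_upwards [h U hU haU] with n hn using hn.trans (Set.subset_sUnion_of_mem hU)

theorem isTopologicalBasis_Theta :
    TopologicalSpace.IsTopologicalBasis (Set.range fun s : T.Triple => Theta s s.β) := by
  refine TopologicalSpace.isTopologicalBasis_of_isOpen_of_nhds ?_ fun a U ha hU => ?_
  · rintro _ ⟨s, rfl⟩
    exact isOpen_Theta s _
  · obtain ⟨s, hs, e⟩ := exists_germ a.hom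
    obtain ⟨n, hn, hsn⟩ := ((exists_Theta_subset hU ha hs e).and
      (eventually_ge_atTop s.β.edges.length)).exists
    obtain ⟨h, h', hu⟩ := mul_idem_initSeg hs hsn
    have key : ∀ {ξ ζ : T.InfPath}, ξ ∈ cylinder (a.left.initSeg n) → s.Maps ξ ζ →
        ∃ h1 : Triple.Maps ⟨⟨s.α.rng, (s.lev a.left n).1, h⟩, (s.lev a.left n).2,
          a.left.initSeg n, h'⟩ ξ ζ, ∀ hs' : s.Maps ξ ζ, germ _ h1 = germ s hs' := by
      intro ξ ζ hξ hs'
      obtain ⟨u, hu1, hu2, hu3⟩ := (idem_maps hξ).mul hs'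
      obtain rfl := Option.some.inj (hu1.symm.trans hu)
      refine ⟨hu2, fun hs' => (germ_eq_iff_lev _ _).2 ?_⟩
      filter_upwards [hu3, lev_idem hξ] with n h1 h2
      rw [h1, h2]; simp
    refine ⟨_, ⟨⟨⟨s.α.rng, (s.lev a.left n).1, h⟩, (s.lev a.left n).2, a.left.initSeg n, h'⟩,
      rfl⟩, ?_, Set.Subset.trans ?_ hn⟩
    · obtain ⟨h1, h2⟩ := key (a.left.mem_cylinder_initSeg n) hs
      exact ⟨a.left.mem_cylinder_initSeg n, h1, e.trans (h2 hs).symm⟩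
    · rintro ⟨x, y, b⟩ ⟨hx, hux, eb⟩
      dsimp only at hx hux eb
      obtain ⟨ζ, hsx⟩ := Triple.exists_maps (cylinder_initSeg_subset hs.mem_cylinder hsn hx)
      obtain ⟨h1, h2⟩ := key hx hsx
      obtain rfl := hux.unique h1
      exact ⟨hx, hsx, eb.trans (h2 hsx)⟩

theorem isCompact_Theta [Finite A] (s : T.Triple) : IsCompact (Theta s s.β) := by
  have hK : CompactSpace (cylinder s.β) :=
    isCompact_iff_compactSpace.1 (isClosed_cylinder s.β).isCompact
  choose m hm using fun η : cylinder s.β => Triple.exists_maps η.2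
  let f : cylinder s.β → Quiver.Total T.InfPath := fun η => ⟨η, m η, germ s (hm η)⟩
  have hf : Continuous f := by
    refine continuous_generateFrom_iff.2 ?_
    rintro _ ⟨t, γ, rfl⟩
    rw [isOpen_iff_mem_nhds]
    rintro η ⟨hγ, ht, e⟩
    dsimp only [f] at hγ ht e
    obtain ⟨δ, hδ, H⟩ := ((germ_eq_iff (hm η) ht).1 e).exists_cylinder
    have ho := (((isOpen_cylinder γ).inter (isOpen_cylinder δ)).inter
      (isOpen_cylinder t.β)).preimage (continuous_subtype_val (p := (· ∈ cylinder s.β)))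
    refine mem_of_superset (ho.mem_nhds ⟨⟨hγ, hδ⟩, ht.mem_cylinder⟩) ?_
    rintro ξ ⟨⟨h1, h2⟩, h3⟩
    obtain ⟨ζ, htx⟩ := Triple.exists_maps h3
    obtain rfl := (H ξ h2).eq_of_maps (hm ξ) htx
    exact ⟨h1, htx, (germ_eq_iff _ _).2 (H ξ h2)⟩
  convert isCompact_range hf
  ext ⟨x, y, a⟩
  constructor
  · rintro ⟨hx, hs, e⟩
    dsimp only at hx hs e
    refine ⟨⟨x, hx⟩, ?_⟩
    obtain rfl := hs.unique (hm ⟨x, hx⟩)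
    rw [e]
  · rintro ⟨η, h⟩
    rw [← h]
    exact ⟨η.2, hm η, rfl⟩

/-- The product `Θ_s Θ_t` is `Θ_{s t}`. -/
theorem setMul_Theta_of_some {s t u : T.Triple} (h : s.mul t = some u) :
    setMul (Theta s s.β) (Theta t t.β) = Theta u u.β := by
  ext ⟨x, z, c⟩
  constructor
  · rintro ⟨y, d, b, hc, ⟨hy, hs, e⟩, ⟨hx, ht, e'⟩⟩
    dsimp only at d b hc hy hs e hx ht e'
    obtain ⟨u', hu, hu', hl⟩ := ht.mul hs
    obtain rfl := Option.some.inj (h.symm.trans hu)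
    refine ⟨hu'.mem_cylinder, hu', ?_⟩
    dsimp only
    rw [← hc, e, e']
    exact (germComp_germ_eq_iff ht hs hu').2 hl
  · rintro ⟨hx, hu, e⟩
    dsimp only at hx hu e
    have key : ∃ y, t.Maps x y ∧ y ∈ cylinder s.β := by
      rw [Triple.mul] at h
      split_ifs at h with h1 h2
      · obtain rfl := Option.some.inj h
        obtain ⟨y, hy⟩ := Triple.exists_maps (s := t) hx
        refine ⟨y, hy, ?_⟩
        have h3 := mem_cylinder.1 hy.mem_cylinder'
        rw [mem_cylinder]
        refine ⟨h3.1.trans h1.1.symm, ?_⟩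
        have h4 := congrArg (List.take s.β.edges.length) h3.2
        rw [Stream'.take_take, min_eq_right h1.2.length_le] at h4
        rw [h4]
        exact (List.prefix_iff_eq_take.1 h1.2).symm
      · obtain rfl := Option.some.inj h
        obtain ⟨ξ, h3, h4⟩ := hx
        simp only [FinPath.extend, Stream'.append_append_stream] at h4
        have h5 : x ∈ cylinder t.β := by
          rw [mem_cylinder, rng_of_append h3 (by
            rw [h4, ← Stream'.append_append_stream]; rfl)]
          refine ⟨rfl, ?_⟩
          rw [h4]
          simpa using stream_take_append t.β.edges _ 0
        obtain ⟨y, hy⟩ := Triple.exists_maps h5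
        refine ⟨y, hy, ?_⟩
        have h7 := mem_cylinder.1 hy.mem_cylinder'
        rw [mem_cylinder]
        refine ⟨h7.1.trans h2.1, ?_⟩
        obtain ⟨ξ', h8, h9, h10⟩ := hy
        have h11 := stream_append_left_cancel (h9.symm.trans h4)
        rw [h11, actInf_append, act_act_inv, ← Stream'.append_append_stream,
          h2.append_remainder] at h10
        rw [h10]
        simpa using stream_take_append s.β.edges _ 0
    obtain ⟨y, hy, hys⟩ := key
    obtain ⟨z', hz⟩ := Triple.exists_maps hys
    obtain ⟨u', hu1, hu2, hl⟩ := hy.mul hz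
    obtain rfl := Option.some.inj (h.symm.trans hu1)
    obtain rfl := hu.unique hu2
    exact ⟨y, germ t hy, germ s hz, ((germComp_germ_eq_iff hy hz hu).2 hl).trans e.symm,
      ⟨hys, hz, rfl⟩, ⟨hy.mem_cylinder, hy, rfl⟩⟩

theorem setMul_Theta_of_none {s t : T.Triple} (h : s.mul t = none) :
    setMul (Theta s s.β) (Theta t t.β) = ∅ := by
  rw [Set.eq_empty_iff_forall_notMem]
  rintro ⟨x, z, c⟩ ⟨y, d, b, hc, ⟨hy, hs, e⟩, ⟨hx, ht, e'⟩⟩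
  obtain ⟨u, hu, -⟩ := ht.mul hs
  rw [h] at hu
  cases hu

theorem isCompact_isOpen_setMul_Theta [Finite A] (s t : T.Triple) :
    IsCompact (setMul (Theta s s.β) (Theta t t.β)) ∧
      IsOpen (setMul (Theta s s.β) (Theta t t.β)) := by
  cases h : s.mul t with
  | none => rw [setMul_Theta_of_none h]; exact ⟨isCompact_empty, isOpen_empty⟩
  | some u => rw [setMul_Theta_of_some h]; exact ⟨isCompact_Theta u, isOpen_Theta u _⟩

theorem isCompact_isOpen_setMul [Finite A] {B D : Set (Quiver.Total T.InfPath)}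
    (hB : IsCompact B ∧ IsOpen B) (hD : IsCompact D ∧ IsOpen D) :
    IsCompact (setMul B D) ∧ IsOpen (setMul B D) := by
  have hc := isCompact_open_iff_eq_finite_iUnion_of_isTopologicalBasis
    (fun s : T.Triple => Theta s s.β) isTopologicalBasis_Theta isCompact_Theta
  obtain ⟨S, hS, rfl⟩ := (hc B).1 hB
  obtain ⟨S', hS', rfl⟩ := (hc D).1 hD
  have : setMul (⋃ s ∈ S, Theta s s.β) (⋃ t ∈ S', Theta t t.β) =
      ⋃ s ∈ S, ⋃ t ∈ S', setMul (Theta s s.β) (Theta t t.β) := by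
    ext c
    simp only [mem_setMul, Set.mem_iUnion]
    constructor
    · rintro ⟨p, ⟨s, hs, h⟩, ⟨t, ht, h'⟩⟩
      exact ⟨s, hs, t, ht, p, h, h'⟩
    · rintro ⟨s, hs, t, ht, p, h, h'⟩
      exact ⟨p, ⟨s, hs, h⟩, ⟨t, ht, h'⟩⟩
  rw [this]
  exact ⟨hS.isCompact_biUnion fun s _ => hS'.isCompact_biUnion fun t _ =>
      (isCompact_isOpen_setMul_Theta s t).1,
    isOpen_biUnion fun s _ => isOpen_biUnion fun t _ => (isCompact_isOpen_setMul_Theta s t).2⟩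

theorem isCompact_isOpen_unitArrows [Finite V] [Finite A] :
    IsCompact (unitArrows T.InfPath) ∧ IsOpen (unitArrows T.InfPath) := by
  have : unitArrows T.InfPath = ⋃ v : V, Theta (T := T) (idem ⟨v, [], trivial⟩) ⟨v, [], trivial⟩ := by
    ext ⟨x, y, a⟩
    simp only [Set.mem_iUnion]
    constructor
    · rintro ⟨z, h⟩
      simp only [Quiver.Total.mk.injEq] at h
      obtain ⟨rfl, rfl, h⟩ := h
      obtain rfl := eq_of_heq h
      exact ⟨z.rng, z.mem_cylinder_initSeg 0, idem_maps (z.mem_cylinder_initSeg 0), rfl⟩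
    · rintro ⟨v, hv, hm, e⟩
      dsimp only at hv hm e
      obtain rfl := hm.unique (idem_maps hv)
      refine ⟨y, ?_⟩
      have hv' : v = y.rng := (mem_cylinder.1 hv).1.symm
      subst hv'
      rw [e]; rfl
  rw [this]
  exact ⟨isCompact_iUnion fun v => isCompact_Theta (idem ⟨v, [], trivial⟩),
    isOpen_iUnion fun v => isOpen_Theta _ _⟩

/-! ### The algebra structure -/

variable {R : Type*} [CommRing R]

theorem conv_mem [Finite A] {f g : Quiver.Total T.InfPath → R}
    (hf : f ∈ steinbergModule R T.InfPath) (hg : g ∈ steinbergModule R T.InfPath) :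
    conv f g ∈ steinbergModule R T.InfPath := by
  induction hf using Submodule.span_induction with
  | mem f hf =>
    induction hg using Submodule.span_induction with
    | mem g hg =>
      obtain ⟨B, h1, h2, h3, rfl⟩ := hf
      obtain ⟨D, h1', h2', h3', rfl⟩ := hg
      rw [conv_indicator h3']
      obtain ⟨h4, h5⟩ := isCompact_isOpen_setMul ⟨h2, h1⟩ ⟨h2', h1'⟩
      exact Submodule.subset_span ⟨_, h5, h4, h3.setMul h3', rfl⟩
    | zero => rw [conv_zero_right]; exact zero_mem _
    | add g g' hg hg' h h' =>
      rw [conv_add_right (sourceFinite_of_mem hg) (sourceFinite_of_mem hg')]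
      exact add_mem h h'
    | smul r g hg h =>
      rw [conv_smul_right r (sourceFinite_of_mem hg)]
      exact Submodule.smul_mem _ r h
  | zero => rw [conv_zero_left]; exact zero_mem _
  | add f f' _ _ h h' =>
    rw [conv_add_left (sourceFinite_of_mem hg)]
    exact add_mem h h'
  | smul r f _ h =>
    rw [conv_smul_left r (sourceFinite_of_mem hg)]
    exact Submodule.smul_mem _ r h

theorem conv_assoc_of_mem [Finite A] {f g k : Quiver.Total T.InfPath → R}
    (hf : f ∈ steinbergModule R T.InfPath) (hg : g ∈ steinbergModule R T.InfPath)
    (hk : k ∈ steinbergModule R T.InfPath) : conv (conv f g) k = conv f (conv g k) := by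
  have hk' := sourceFinite_of_mem hk
  induction hf using Submodule.span_induction with
  | mem f hf =>
    induction hg using Submodule.span_induction with
    | mem g hg =>
      induction hk using Submodule.span_induction with
      | mem k hk =>
        obtain ⟨B, h1, h2, h3, rfl⟩ := hf
        obtain ⟨C, h1', h2', h3', rfl⟩ := hg
        obtain ⟨D, h1'', h2'', h3'', rfl⟩ := hk
        rw [conv_indicator h3', conv_indicator h3'', conv_indicator h3'',
          conv_indicator (h3'.setMul h3''), setMul_assoc]
      | zero => simp
      | add k l hk hl h h' =>
        have a := sourceFinite_of_mem hk
        have b := sourceFinite_of_mem hl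
        have hg' : g ∈ steinbergModule R T.InfPath := Submodule.subset_span hg
        rw [conv_add_right a b, conv_add_right a b,
          conv_add_right (sourceFinite_of_mem (conv_mem hg' hk))
            (sourceFinite_of_mem (conv_mem hg' hl)), h a, h' b]
      | smul r k hk h =>
        have a := sourceFinite_of_mem hk
        have hg' : g ∈ steinbergModule R T.InfPath := Submodule.subset_span hg
        rw [conv_smul_right r a, conv_smul_right r a,
          conv_smul_right r (sourceFinite_of_mem (conv_mem hg' hk)), h a]
    | zero => simp
    | add g g' hg hg' h h' =>
      rw [conv_add_right (sourceFinite_of_mem hg) (sourceFinite_of_mem hg'),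
        conv_add_left hk', conv_add_left hk',
        conv_add_right (sourceFinite_of_mem (conv_mem hg hk))
          (sourceFinite_of_mem (conv_mem hg' hk)), h, h']
    | smul r g hg h =>
      rw [conv_smul_right r (sourceFinite_of_mem hg), conv_smul_left r hk',
        conv_smul_left r hk', conv_smul_right r (sourceFinite_of_mem (conv_mem hg hk)), h]
  | zero => simp
  | add f f' _ _ h h' =>
    rw [conv_add_left (sourceFinite_of_mem hg), conv_add_left hk', h, h',
      conv_add_left (sourceFinite_of_mem (conv_mem hg hk))]
  | smul r f _ h =>
    rw [conv_smul_left r (sourceFinite_of_mem hg), conv_smul_left r hk', h,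
      conv_smul_left r (sourceFinite_of_mem (conv_mem hg hk))]

theorem one_conv_of_mem {f : Quiver.Total T.InfPath → R}
    (hf : f ∈ steinbergModule R T.InfPath) :
    conv ((unitArrows T.InfPath).indicator 1) f = f := by
  induction hf using Submodule.span_induction with
  | mem f hf =>
    obtain ⟨B, -, -, h, rfl⟩ := hf
    rw [conv_indicator h, unitArrows_setMul]
  | zero => simp
  | add f f' hf hf' h h' =>
    rw [conv_add_right (sourceFinite_of_mem hf) (sourceFinite_of_mem hf'), h, h']
  | smul r f hf h => rw [conv_smul_right r (sourceFinite_of_mem hf), h]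

theorem unit_mem [Finite V] [Finite A] :
    (unitArrows T.InfPath).indicator 1 ∈ steinbergModule R T.InfPath :=
  Submodule.subset_span ⟨_, isCompact_isOpen_unitArrows.2, isCompact_isOpen_unitArrows.1,
    isBisection_unitArrows, rfl⟩

theorem conv_one_of_mem [Finite V] [Finite A] {f : Quiver.Total T.InfPath → R}
    (hf : f ∈ steinbergModule R T.InfPath) :
    conv f ((unitArrows T.InfPath).indicator 1) = f := by
  have h0 := sourceFinite_of_mem (unit_mem (T := T) (R := R))
  induction hf using Submodule.span_induction with
  | mem f hf =>
    obtain ⟨B, -, -, h, rfl⟩ := hf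
    rw [conv_indicator isBisection_unitArrows, setMul_unitArrows]
  | zero => simp
  | add f f' hf hf' h h' => rw [conv_add_left h0, h, h']
  | smul r f hf h => rw [conv_smul_left r h0, h]

noncomputable instance : AddCommGroup (SteinbergAlgebra R T.InfPath) :=
  inferInstanceAs (AddCommGroup ↥(steinbergModule R T.InfPath))

noncomputable instance : Module R (SteinbergAlgebra R T.InfPath) :=
  inferInstanceAs (Module R ↥(steinbergModule R T.InfPath))

/-- The Steinberg algebra of the groupoid of germs is a ring under convolution; its unit is the
characteristic function of the unit space. -/
noncomputable instance [Finite V] [Finite A] : Ring (SteinbergAlgebra R T.InfPath) :=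
  { (inferInstance : AddCommGroup (SteinbergAlgebra R T.InfPath)) with
    mul := fun f g => ⟨conv f.1 g.1, conv_mem f.2 g.2⟩
    one := ⟨(unitArrows T.InfPath).indicator 1, unit_mem⟩
    left_distrib := fun f g h => Subtype.ext
      (conv_add_right (sourceFinite_of_mem g.2) (sourceFinite_of_mem h.2))
    right_distrib := fun _ _ h => Subtype.ext (conv_add_left (sourceFinite_of_mem h.2))
    zero_mul := fun _ => Subtype.ext (conv_zero_left _)
    mul_zero := fun _ => Subtype.ext (conv_zero_right _)
    mul_assoc := fun f g h => Subtype.ext (conv_assoc_of_mem f.2 g.2 h.2)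
    one_mul := fun f => Subtype.ext (one_conv_of_mem f.2)
    mul_one := fun f => Subtype.ext (conv_one_of_mem f.2) }

noncomputable instance [Finite V] [Finite A] : Algebra R (SteinbergAlgebra R T.InfPath) :=
  Algebra.ofModule (fun r _ g => Subtype.ext (conv_smul_left r (sourceFinite_of_mem g.2)))
    (fun r _ g => Subtype.ext (conv_smul_right r (sourceFinite_of_mem g.2)))

theorem indicator_mem_of_isCompact_isOpen [Finite A] [T2Space (Quiver.Total T.InfPath)]
    {C : Set (Quiver.Total T.InfPath)} (hC : IsCompact C) (hC' : IsOpen C) :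
    C.indicator (1 : Quiver.Total T.InfPath → R) ∈ steinbergModule R T.InfPath := by
  classical
  obtain ⟨S, hS, rfl⟩ := (isCompact_open_iff_eq_finite_iUnion_of_isTopologicalBasis
    (fun s : T.Triple => Theta s s.β) isTopologicalBasis_Theta isCompact_Theta C).1 ⟨hC, hC'⟩
  clear hC hC'
  induction S, hS using Set.Finite.induction_on with
  | empty =>
    have : (∅ : Set (Quiver.Total T.InfPath)).indicator (1 : Quiver.Total T.InfPath → R) = 0 :=
      Set.indicator_empty _
    simp only [Set.mem_empty_iff_false, Set.iUnion_of_empty, Set.iUnion_empty, this]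
    exact zero_mem _
  | @insert s S _ hS ih =>
    have hK : IsCompact (⋃ t ∈ S, Theta t t.β) := hS.isCompact_biUnion fun t _ => isCompact_Theta t
    have hO : IsOpen (⋃ t ∈ S, Theta t t.β) := isOpen_biUnion fun t _ => isOpen_Theta t _
    rw [Set.biUnion_insert, Set.union_comm, ← Set.union_sdiff_self,
      Set.indicator_union_of_disjoint Set.disjoint_sdiff_right]
    refine add_mem ih (Submodule.subset_span ⟨_, (isOpen_Theta s _).sdiff hK.isClosed,
      (isCompact_Theta s).diff hO, ?_, rfl⟩)
    exact ⟨(Theta_isBisection s _).1.mono Set.sdiff_subset,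
      (Theta_isBisection s _).2.mono Set.sdiff_subset⟩

/-- If the groupoid is Hausdorff, then the Steinberg algebra consists of all locally constant
functions with compact support. -/
theorem mem_steinbergModule_iff [Finite A] [T2Space (Quiver.Total T.InfPath)]
    {f : Quiver.Total T.InfPath → R} :
    f ∈ steinbergModule R T.InfPath ↔ IsLocallyConstant f ∧ IsCompact (Function.support f) := by
  classical
  constructor
  · intro hf
    induction hf using Submodule.span_induction with
    | mem f hf =>
      obtain ⟨B, h1, h2, -, rfl⟩ := hf
      have hl : IsLocallyConstant (B.indicator (1 : Quiver.Total T.InfPath → R)) :=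
        by
        rw [← LocallyConstant.coe_charFn R ⟨h2.isClosed, h1⟩]
        exact LocallyConstant.isLocallyConstant _
      exact ⟨hl, h2.of_isClosed_subset (hl.isOpen_fiber 0).isClosed_compl Set.support_indicator_subset⟩
    | zero => exact ⟨IsLocallyConstant.const 0, by simp⟩
    | add f g _ _ hf hg =>
      refine ⟨hf.1.add hg.1, (hf.2.union hg.2).of_isClosed_subset
        ((hf.1.add hg.1).isOpen_fiber 0).isClosed_compl (Function.support_add f g)⟩
    | smul r f _ hf =>
      have hl : IsLocallyConstant (r • f) := hf.1.comp (r * ·)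
      exact ⟨hl, hf.2.of_isClosed_subset (hl.isOpen_fiber 0).isClosed_compl
        (Function.support_const_smul_subset r f)⟩
  · rintro ⟨hl, hK⟩
    have hfin : (f '' Function.support f).Finite := by
      let _ : TopologicalSpace R := ⊥
      have _ : DiscreteTopology R := ⟨rfl⟩
      exact isCompact_iff_finite.1 (hK.image hl.continuous)
    have : f = ∑ r ∈ hfin.toFinset, r • (f ⁻¹' {r}).indicator 1 := by
      funext c
      rw [Finset.sum_apply]
      by_cases hc : f c = 0
      · rw [hc, Finset.sum_eq_zero]
        intro r hr
        obtain ⟨d, hd, rfl⟩ := hfin.mem_toFinset.1 hr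
        have : c ∉ f ⁻¹' {f d} := fun h => hd (by rw [← hc]; exact h.symm)
        simp [this]
      · rw [Finset.sum_eq_single (f c)]
        · simp
        · intro r _ hr
          have : c ∉ f ⁻¹' {r} := fun h => hr h.symm
          simp [this]
        · exact fun h => absurd (hfin.mem_toFinset.2 ⟨c, hc, rfl⟩) h
    rw [this]
    refine Submodule.sum_mem _ fun r hr => Submodule.smul_mem _ r ?_
    obtain ⟨d, hd, rfl⟩ := hfin.mem_toFinset.1 hr
    refine indicator_mem_of_isCompact_isOpen (hK.of_isClosed_subset (hl.isClosed_fiber _) ?_)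
      (hl.isOpen_fiber _)
    intro c hc h0
    exact hd (by rw [← h0]; exact hc.symm)

variable (R) in
/-- The characteristic function of `Θ((α, g, β); Z(β))`, as an element of the Steinberg
algebra. -/
noncomputable def charTheta [Finite A] (s : T.Triple) : SteinbergAlgebra R T.InfPath :=
  ⟨(Theta s s.β).indicator 1, Submodule.subset_span
    ⟨_, isOpen_Theta s _, isCompact_Theta s, Theta_isBisection s _, rfl⟩⟩

/-! ### The algebra given by generators and relations -/

variable (T)

/-- The generators `p_x`, `s_a`, `s_a*`, `u_g`. -/
inductive Gen (T : GraphTriple G V A)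
  | p (x : V) : Gen T
  | s (a : A) : Gen T
  | sStar (a : A) : Gen T
  | u (g : G) : Gen T

variable (R)

/-- The generator `p_x` of the free algebra. -/
def fp (x : V) : FreeAlgebra R T.Gen := FreeAlgebra.ι R (Gen.p x)
/-- The generator `s_a` of the free algebra. -/
def fs (a : A) : FreeAlgebra R T.Gen := FreeAlgebra.ι R (Gen.s a)
/-- The generator `s_a*` of the free algebra. -/
def fsStar (a : A) : FreeAlgebra R T.Gen := FreeAlgebra.ι R (Gen.sStar a)
/-- The generator `u_g` of the free algebra. -/
def fu (g : G) : FreeAlgebra R T.Gen := FreeAlgebra.ι R (Gen.u g)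

open Classical in
/-- The defining relations. -/
inductive Rel [Fintype V] [Fintype A] : FreeAlgebra R T.Gen → FreeAlgebra R T.Gen → Prop
  /-- the `p_x` are pairwise orthogonal idempotents -/
  | p_mul_p (x y : V) : Rel (T.fp R x * T.fp R y) (if x = y then T.fp R x else 0)
  /-- the sum of the `p_x` is the unit -/
  | sum_p : Rel (∑ x : V, T.fp R x) 1
  /-- `s_a` has range `p_{r(a)}` and source `p_{s(a)}` -/
  | p_mul_s (a : A) : Rel (T.fp R (T.r a) * T.fs R a) (T.fs R a)
  | s_mul_p (a : A) : Rel (T.fs R a * T.fp R (T.s a)) (T.fs R a)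
  | sStar_mul_p (a : A) : Rel (T.fsStar R a * T.fp R (T.r a)) (T.fsStar R a)
  | p_mul_sStar (a : A) : Rel (T.fp R (T.s a) * T.fsStar R a) (T.fsStar R a)
  /-- the Cuntz-Krieger relations -/
  | sStar_mul_s (a b : A) :
      Rel (T.fsStar R a * T.fs R b) (if a = b then T.fp R (T.s a) else 0)
  | sum_s (x : V) :
      Rel (∑ a : A with T.r a = x, T.fs R a * T.fsStar R a) (T.fp R x)
  /-- `g ↦ u_g` is a unitary representation of the group -/
  | u_one : Rel (T.fu R 1) 1
  | u_mul (g h : G) : Rel (T.fu R (g * h)) (T.fu R g * T.fu R h)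
  /-- `u_g s_a = s_{g a} u_{φ(g, a)}`, and the adjoint of this relation -/
  | u_mul_s (g : G) (a : A) :
      Rel (T.fu R g * T.fs R a) (T.fs R (g • a) * T.fu R (T.φ g a))
  | sStar_mul_u (g : G) (a : A) :
      Rel (T.fsStar R a * T.fu R g⁻¹) (T.fu R (T.φ g a)⁻¹ * T.fsStar R (g • a))
  /-- `u_g p_x = p_{g x} u_g` -/
  | u_mul_p (g : G) (x : V) :
      Rel (T.fu R g * T.fp R x) (T.fp R (g • x) * T.fu R g)

variable [Fintype V] [Fintype A]

/-- The algebraic Exel-Pardo algebra of `(G, E, φ)` over `R`: the universal unital `R`-algebra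
with the generators and relations above. -/
abbrev ExelPardoAlgebra := RingQuot (T.Rel R)

/-- `p_x` -/
def p (x : V) : T.ExelPardoAlgebra R := RingQuot.mkAlgHom R (T.Rel R) (T.fp R x)
/-- `s_a` for an edge `a` -/
def sEdge (a : A) : T.ExelPardoAlgebra R := RingQuot.mkAlgHom R (T.Rel R) (T.fs R a)
/-- `s_a*` for an edge `a` -/
def sEdgeStar (a : A) : T.ExelPardoAlgebra R := RingQuot.mkAlgHom R (T.Rel R) (T.fsStar R a)
/-- `u_g` -/
def u (g : G) : T.ExelPardoAlgebra R := RingQuot.mkAlgHom R (T.Rel R) (T.fu R g)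

variable {T}

/-- `s_α = s_{a₁} ⋯ s_{aₙ}` for a path `α = a₁ ⋯ aₙ` with `n ≥ 1`, and `s_x = p_x` for a
vertex `x`. -/
def sPath (α : T.FinPath) : T.ExelPardoAlgebra R :=
  if α.edges.isEmpty then T.p R α.rng else (α.edges.map (T.sEdge R)).prod

/-- `s_α* = s_{aₙ}* ⋯ s_{a₁}*` for a path `α = a₁ ⋯ aₙ` with `n ≥ 1`, and `s_x* = p_x` for a
vertex `x`. -/
def sPathStar (α : T.FinPath) : T.ExelPardoAlgebra R :=
  if α.edges.isEmpty then T.p R α.rng else (α.edges.reverse.map (T.sEdgeStar R)).prod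

end GraphTriple
end ExelPardo

/-! The universal property gives maps out of the algebra of generators and relations, so the
homomorphism is built in the direction opposite to `Φ` and inverted at the end. Let Θ_s stand for
`Theta s s.β`. Since Θ_s Θ_t is Θ_{st}, or empty when st = 0, the functions `charTheta R s` multiply
like the inverse semigroup. A relation without sums thus reduces to an identity between triples,
once `charUnit` is expanded. The relations Σ p_x = 1 and p_x = Σ s_a s_a* say that the infinite path
space is partitioned by the cylinders of vertices, and Z(x) by those of the edges with range x. The
resulting `toSteinberg` sends s_α u_g s_β* to `charTheta` (`toSteinberg_monomial`).

Surjectivity: a compact open bisection is a finite union of sets Θ_s. These may overlap, and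
intersections need not be compact when the groupoid is not Hausdorff. But if C ∪ Θ_s is a bisection,
then Θ_s ∩ C = Θ_s D, where D is the set of units over the sources of C. Hence 1_{C ∪ Θ_s} = 1_C +
1_{Θ_s} − 1_{Θ_s} * 1_D, and induction on the number of sets applies (`IsAttained.union_Theta`),
first to sets of units and then in general.

Injectivity: the monomials s_α u_g s_β* span the algebra (`mem_monomialSpan`). Fix an infinite path
η, with initial segments η|ₙ. For large n the product of a monomial with s_{η|ₙ} depends only on the
germ of (α, g, β) at η, and it is zero if η is not in Z(β). If x lies in the kernel, its
coefficients add up to zero over each germ at η, so x s_{η|ₙ} = 0 for large n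
(`eventually_mul_edgeProd_take_eq_zero`). If however x ≠ 0, the identity y p_v = Σ y s_a s_a* shows
that a nonzero y p_v has some nonzero y s_a. Choosing edges one after another yields an η with x
s_{η|ₙ} ≠ 0 for all n (`exists_infPath_mul_edgeProd_ne_zero`), a contradiction. Hausdorffness plays
no role. -/

namespace ExelPardo

open CategoryTheory Filter

variable {G V A : Type*} [Group G] [MulAction G V] [MulAction G A]

namespace GraphTriple

section Algebra

variable {T : GraphTriple G V A} {R : Type*} [CommRing R] [Fintype V] [Fintype A]

/-! ### The relations in the Exel-Pardo algebra -/

theorem mk_eq_of_rel {x y : FreeAlgebra R T.Gen} (h : T.Rel R x y) :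
    RingQuot.mkAlgHom R (T.Rel R) x = RingQuot.mkAlgHom R (T.Rel R) y :=
  RingQuot.mkAlgHom_rel R h

theorem p_mul_p_self (x : V) : T.p R x * T.p R x = T.p R x := by
  simpa [p] using mk_eq_of_rel (Rel.p_mul_p (T := T) (R := R) x x)

theorem p_mul_p_of_ne {x y : V} (h : x ≠ y) : T.p R x * T.p R y = 0 := by
  simpa [p, h] using mk_eq_of_rel (Rel.p_mul_p (T := T) (R := R) x y)

variable (T R) in
theorem sum_p_eq_one : ∑ x : V, T.p R x = 1 := by
  simpa [p] using mk_eq_of_rel (Rel.sum_p (T := T) (R := R))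

@[simp] theorem p_mul_sEdge (a : A) : T.p R (T.r a) * T.sEdge R a = T.sEdge R a := by
  simpa [p, sEdge] using mk_eq_of_rel (Rel.p_mul_s (T := T) (R := R) a)

@[simp] theorem sEdge_mul_p (a : A) : T.sEdge R a * T.p R (T.s a) = T.sEdge R a := by
  simpa [p, sEdge] using mk_eq_of_rel (Rel.s_mul_p (T := T) (R := R) a)

@[simp] theorem sEdgeStar_mul_p (a : A) :
    T.sEdgeStar R a * T.p R (T.r a) = T.sEdgeStar R a := by
  simpa [p, sEdgeStar] using mk_eq_of_rel (Rel.sStar_mul_p (T := T) (R := R) a)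

@[simp] theorem p_mul_sEdgeStar (a : A) :
    T.p R (T.s a) * T.sEdgeStar R a = T.sEdgeStar R a := by
  simpa [p, sEdgeStar] using mk_eq_of_rel (Rel.p_mul_sStar (T := T) (R := R) a)

theorem sEdgeStar_mul_sEdge_self (a : A) :
    T.sEdgeStar R a * T.sEdge R a = T.p R (T.s a) := by
  simpa [p, sEdge, sEdgeStar] using mk_eq_of_rel (Rel.sStar_mul_s (T := T) (R := R) a a)

theorem sEdgeStar_mul_sEdge_of_ne {a b : A} (h : a ≠ b) :
    T.sEdgeStar R a * T.sEdge R b = 0 := by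
  simpa [h, sEdge, sEdgeStar] using mk_eq_of_rel (Rel.sStar_mul_s (T := T) (R := R) a b)

open Classical in
variable (T R) in
theorem sum_sEdge_mul_sEdgeStar (x : V) :
    ∑ a : A with T.r a = x, T.sEdge R a * T.sEdgeStar R a = T.p R x := by
  simpa [p, sEdge, sEdgeStar] using mk_eq_of_rel (Rel.sum_s (T := T) (R := R) x)

@[simp] theorem u_one : T.u R 1 = 1 := by
  simpa [u] using mk_eq_of_rel (Rel.u_one (T := T) (R := R))

theorem u_mul (g h : G) : T.u R (g * h) = T.u R g * T.u R h := by
  simpa [u] using mk_eq_of_rel (Rel.u_mul (T := T) (R := R) g h)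

theorem u_mul_sEdge (g : G) (a : A) :
    T.u R g * T.sEdge R a = T.sEdge R (g • a) * T.u R (T.φ g a) := by
  simpa [u, sEdge] using mk_eq_of_rel (Rel.u_mul_s (T := T) (R := R) g a)

theorem sEdgeStar_mul_u (g : G) (a : A) :
    T.sEdgeStar R a * T.u R g⁻¹ = T.u R (T.φ g a)⁻¹ * T.sEdgeStar R (g • a) := by
  simpa [u, sEdgeStar] using mk_eq_of_rel (Rel.sStar_mul_u (T := T) (R := R) g a)

theorem u_mul_p (g : G) (x : V) : T.u R g * T.p R x = T.p R (g • x) * T.u R g := by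
  simpa [u, p] using mk_eq_of_rel (Rel.u_mul_p (T := T) (R := R) g x)

theorem p_mul_sEdge_of_ne {x : V} {a : A} (h : x ≠ T.r a) : T.p R x * T.sEdge R a = 0 := by
  rw [← p_mul_sEdge, ← mul_assoc, p_mul_p_of_ne h, zero_mul]

theorem sEdge_mul_p_of_ne {x : V} {a : A} (h : T.s a ≠ x) : T.sEdge R a * T.p R x = 0 := by
  rw [← sEdge_mul_p, mul_assoc, p_mul_p_of_ne h, mul_zero]

theorem sEdgeStar_mul_p_of_ne {x : V} {a : A} (h : T.r a ≠ x) :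
    T.sEdgeStar R a * T.p R x = 0 := by
  rw [← sEdgeStar_mul_p, mul_assoc, p_mul_p_of_ne h, mul_zero]

/-! ### Products along lists of edges -/

variable (T R)

/-- The product `s_{a₁} ⋯ s_{aₙ}`. -/
def edgeProd (l : List A) : T.ExelPardoAlgebra R := (l.map (T.sEdge R)).prod

/-- The product `s_{aₙ}* ⋯ s_{a₁}*`. -/
def edgeStarProd (l : List A) : T.ExelPardoAlgebra R := (l.reverse.map (T.sEdgeStar R)).prod

variable {T R}

@[simp] theorem edgeProd_nil : T.edgeProd R [] = 1 := rfl

@[simp] theorem edgeStarProd_nil : T.edgeStarProd R [] = 1 := rfl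

theorem edgeProd_cons (a : A) (l : List A) :
    T.edgeProd R (a :: l) = T.sEdge R a * T.edgeProd R l := by simp [edgeProd]

theorem edgeStarProd_cons (a : A) (l : List A) :
    T.edgeStarProd R (a :: l) = T.edgeStarProd R l * T.sEdgeStar R a := by simp [edgeStarProd]

theorem edgeProd_append (l m : List A) :
    T.edgeProd R (l ++ m) = T.edgeProd R l * T.edgeProd R m := by simp [edgeProd]

theorem edgeStarProd_append (l m : List A) :
    T.edgeStarProd R (l ++ m) = T.edgeStarProd R m * T.edgeStarProd R l := by
  simp [edgeStarProd]

theorem p_mul_edgeProd_cons {x : V} {a : A} (h : T.r a = x) (l : List A) :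
    T.p R x * T.edgeProd R (a :: l) = T.edgeProd R (a :: l) := by
  rw [edgeProd_cons, ← mul_assoc, ← h, p_mul_sEdge]

theorem edgeStarProd_cons_mul_p {x : V} {a : A} (h : T.r a = x) (l : List A) :
    T.edgeStarProd R (a :: l) * T.p R x = T.edgeStarProd R (a :: l) := by
  rw [edgeStarProd_cons, mul_assoc, ← h, sEdgeStar_mul_p]

/-- The projection at the range is absorbed by a nonempty product and is the whole value on a
vertex. This gives one formula for all lengths, with no separate case for vertices. -/
theorem sPath_eq (α : T.FinPath) : sPath R α = T.p R α.rng * T.edgeProd R α.edges := by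
  obtain ⟨x, l, hl⟩ := α
  cases l with
  | nil => simp [sPath]
  | cons a l => rw [p_mul_edgeProd_cons hl.1]; simp [sPath, edgeProd]

theorem sPathStar_eq (α : T.FinPath) :
    sPathStar R α = T.edgeStarProd R α.edges * T.p R α.rng := by
  obtain ⟨x, l, hl⟩ := α
  cases l with
  | nil => simp [sPathStar]
  | cons a l => rw [edgeStarProd_cons_mul_p hl.1]; simp [sPathStar, edgeStarProd]

/-- The product telescopes from the inside by s_a* s_a = p_{s(a)}. The projection in the middle is
what makes the formula right for the empty list, where both edge products are 1. -/
theorem edgeStarProd_mul_edgeProd {x : V} {l : List A} (h : T.IsPath x l) :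
    T.edgeStarProd R l * T.p R x * T.edgeProd R l = T.p R (T.endVertex x l) := by
  induction l generalizing x with
  | nil => simp [endVertex]
  | cons a l ih =>
    rw [edgeStarProd_cons, edgeProd_cons, endVertex, ← ih h.2, ← sEdgeStar_mul_sEdge_self]
    obtain rfl := h.1
    rw [mul_assoc (T.edgeStarProd R l), sEdgeStar_mul_p]
    simp only [mul_assoc]

theorem u_mul_edgeProd (g : G) (l : List A) :
    T.u R g * T.edgeProd R l = T.edgeProd R (T.act g l) * T.u R (T.coc g l) := by
  induction l generalizing g with
  | nil => simp
  | cons a l ih =>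
    rw [edgeProd_cons, ← mul_assoc, u_mul_sEdge, mul_assoc, ih, act, coc, edgeProd_cons,
      mul_assoc]

theorem sEdgeStar_mul_edgeProd_of_ne {a b : A} (h : a ≠ b) (l : List A) :
    T.sEdgeStar R a * T.edgeProd R (b :: l) = 0 := by
  rw [edgeProd_cons, ← mul_assoc, sEdgeStar_mul_sEdge_of_ne h, zero_mul]

/-- `s_l* s_m = 0` if neither of the two lists is an initial segment of the other; here the second
one is assumed to be the longer one. -/
theorem edgeStarProd_mul_edgeProd_eq_zero {l m : List A} (hlm : l.length ≤ m.length)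
    (h : ¬ l <+: m) : T.edgeStarProd R l * T.edgeProd R m = 0 := by
  induction l generalizing m with
  | nil => exact absurd m.nil_prefix h
  | cons a l ih =>
    cases m with
    | nil => simp at hlm
    | cons b m =>
      rw [edgeStarProd_cons, mul_assoc]
      by_cases hab : a = b
      · subst hab
        have h' : ¬ l <+: m := fun h' => h (by simpa using h')
        rw [edgeProd_cons, ← mul_assoc (T.sEdgeStar R a), sEdgeStar_mul_sEdge_self]
        -- The projection p_{s(a)} is left between the two tails. It disappears if the next edge
        -- starts at s(a) and gives zero otherwise; the lists are not assumed to be paths. If no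
        -- edge is left, the length bound forces `l` to be empty, hence a prefix.
        cases m with
        | nil =>
          obtain rfl : l = [] := by simpa using hlm
          exact absurd List.prefix_rfl h'
        | cons c m =>
          by_cases hc : T.r c = T.s a
          · rw [p_mul_edgeProd_cons hc, ih (by simpa using hlm) h']
          · rw [edgeProd_cons, ← mul_assoc (T.p R _), p_mul_sEdge_of_ne (Ne.symm hc), zero_mul,
              mul_zero]
      · rw [sEdgeStar_mul_edgeProd_of_ne hab, mul_zero]

/-! ### A spanning set -/

variable (R) in
/-- The element `s_α u_g s_β*`. -/
def monomial (t : T.Triple) : T.ExelPardoAlgebra R := sPath R t.α * T.u R t.g * sPathStar R t.β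

variable (T R) in
/-- The submodule spanned by the elements `s_α u_g s_β*`. -/
def monomialSpan : Submodule R (T.ExelPardoAlgebra R) := Submodule.span R (Set.range (monomial R))

theorem monomial_mem (t : T.Triple) : monomial R t ∈ T.monomialSpan R :=
  Submodule.subset_span ⟨t, rfl⟩

theorem monomial_eq (t : T.Triple) : monomial R t =
    T.p R t.α.rng * T.edgeProd R t.α.edges * T.u R t.g *
      (T.edgeStarProd R t.β.edges * T.p R t.β.rng) := by
  rw [monomial, sPath_eq, sPathStar_eq]

theorem monomial_idem_vertex (x : V) : monomial R (T := T) (idem ⟨x, [], trivial⟩) = T.p R x := by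
  simp [monomial_eq, idem, p_mul_p_self]

theorem p_mul_monomial_mem (x : V) (t : T.Triple) :
    T.p R x * monomial R t ∈ T.monomialSpan R := by
  have e : T.p R x * monomial R t = T.p R x * T.p R t.α.rng * T.edgeProd R t.α.edges *
      T.u R t.g * (T.edgeStarProd R t.β.edges * T.p R t.β.rng) := by
    simp only [monomial_eq, mul_assoc]
  by_cases h : x = t.α.rng
  · rw [e, h, p_mul_p_self, ← monomial_eq]
    exact monomial_mem t
  · rw [e, p_mul_p_of_ne h]
    simp

/-- Either α can be prolonged to the path aα, or p_{s(a)} and the projection at the range of α are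
orthogonal. -/
theorem sEdge_mul_monomial_mem (a : A) (t : T.Triple) :
    T.sEdge R a * monomial R t ∈ T.monomialSpan R := by
  have e : T.sEdge R a * monomial R t = T.sEdge R a * T.p R t.α.rng * T.edgeProd R t.α.edges *
      T.u R t.g * (T.edgeStarProd R t.β.edges * T.p R t.β.rng) := by
    simp only [monomial_eq, mul_assoc]
  by_cases h : T.s a = t.α.rng
  · have hd : T.endVertex (T.r a) (a :: t.α.edges) = t.g • t.β.d := by
      rw [endVertex, h]; exact t.d_eq
    have hp : T.IsPath (T.r a) (a :: t.α.edges) := ⟨rfl, by rw [h]; exact t.α.valid⟩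
    have := monomial_mem (R := R) (⟨⟨T.r a, a :: t.α.edges, hp⟩, t.g, t.β, hd⟩ : T.Triple)
    rw [monomial_eq, p_mul_edgeProd_cons rfl, edgeProd_cons] at this
    rwa [e, ← h, sEdge_mul_p]
  · rw [e, sEdge_mul_p_of_ne h]
    simp

/-- Moving u_g to the right across s_α turns α into gα and leaves u_{φ(g, α)}, which merges with the
group element of the monomial. -/
theorem u_mul_monomial_mem (g : G) (t : T.Triple) :
    T.u R g * monomial R t ∈ T.monomialSpan R := by
  have := monomial_mem (R := R) (⟨⟨g • t.α.rng, T.act g t.α.edges, isPath_act g t.α.valid⟩,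
    T.coc g t.α.edges * t.g, t.β, by
      rw [FinPath.d, endVertex_act, mul_smul, ← t.d_eq, coc_smul]; rfl⟩ : T.Triple)
  convert this using 1
  simp only [monomial_eq, u_mul]
  simp only [← mul_assoc]
  rw [u_mul_p, mul_assoc _ (T.u R g), u_mul_edgeProd]
  simp only [← mul_assoc]

/-- If α begins with an edge, s_a* cancels it or gives zero. If α is a vertex, s_a* has to pass u_g,
and it then lengthens β by the edge g⁻¹a. -/
theorem sEdgeStar_mul_monomial_mem (a : A) (t : T.Triple) :
    T.sEdgeStar R a * monomial R t ∈ T.monomialSpan R := by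
  obtain ⟨⟨x, l, hl⟩, g, β, hd⟩ := t
  cases l with
  | nil =>
    change x = g • β.d at hd
    have e : T.sEdgeStar R a * monomial R (⟨⟨x, [], hl⟩, g, β, hd⟩ : T.Triple) =
        T.sEdgeStar R a * T.p R x * T.u R g * (T.edgeStarProd R β.edges * T.p R β.rng) := by
      simp only [monomial_eq, mul_assoc, edgeProd_nil, one_mul]
    by_cases h : T.r a = x
    · have hp : T.IsPath β.d [g⁻¹ • a] := ⟨by rw [T.r_smul, h, hd, inv_smul_smul], trivial⟩
      have hd' : (⟨T.s a, [], trivial⟩ : T.FinPath).d =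
          (T.φ g⁻¹ a)⁻¹ • (β.extend [g⁻¹ • a] hp).d := by
        rw [FinPath.d_extend, endVertex, endVertex, T.s_smul, ← T.φ_smul g⁻¹ a, inv_smul_smul]
        rfl
      have := monomial_mem (R := R)
        (⟨⟨T.s a, [], trivial⟩, (T.φ g⁻¹ a)⁻¹, β.extend [g⁻¹ • a] hp, hd'⟩ : T.Triple)
      convert this using 1
      rw [e, ← h, sEdgeStar_mul_p, monomial_eq]
      -- The relation at g⁻¹ reads s_a* u_g = u_k s_{g⁻¹a}* with k = φ(g⁻¹, a)⁻¹. As φ(g⁻¹, a) acts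
      -- on vertices like g⁻¹, the projection p_{s(a)} passes u_k as p_{s(g⁻¹a)}, and s_{g⁻¹a}*
      -- absorbs it.
      have h1 := sEdgeStar_mul_u (T := T) (R := R) g⁻¹ a
      rw [inv_inv] at h1
      have h2 : T.p R (T.s a) * T.u R (T.φ g⁻¹ a)⁻¹ =
          T.u R (T.φ g⁻¹ a)⁻¹ * T.p R (T.s (g⁻¹ • a)) := by
        rw [u_mul_p, T.s_smul, ← T.φ_smul g⁻¹ a, inv_smul_smul]
      rw [h1]
      simp only [FinPath.extend, edgeProd_nil, mul_one, h2, edgeStarProd_append,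
        edgeStarProd_cons, edgeStarProd_nil, one_mul, mul_assoc]
      rw [← mul_assoc (T.p R _) (T.sEdgeStar R _), p_mul_sEdgeStar]
    · rw [e, sEdgeStar_mul_p_of_ne h]
      simp
  | cons b l =>
    have e : T.sEdgeStar R a * monomial R (⟨⟨x, b :: l, hl⟩, g, β, hd⟩ : T.Triple) =
        T.sEdgeStar R a * T.sEdge R b * T.edgeProd R l * T.u R g *
          (T.edgeStarProd R β.edges * T.p R β.rng) := by
      rw [monomial_eq, p_mul_edgeProd_cons hl.1]
      simp only [edgeProd_cons, mul_assoc]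
    by_cases h : a = b
    · rw [e, h, sEdgeStar_mul_sEdge_self]
      have := monomial_mem (R := R) (⟨⟨T.s b, l, hl.2⟩, g, β, hd⟩ : T.Triple)
      rwa [monomial_eq] at this
    · rw [e, sEdgeStar_mul_sEdge_of_ne h]
      simp

theorem one_mem_monomialSpan : (1 : T.ExelPardoAlgebra R) ∈ T.monomialSpan R := by
  rw [← sum_p_eq_one T R]
  refine Submodule.sum_mem _ fun x _ => ?_
  rw [← monomial_idem_vertex]
  exact monomial_mem _

theorem mul_mem_monomialSpan_of_monomial {w m : T.ExelPardoAlgebra R}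
    (h : ∀ t : T.Triple, w * monomial R t ∈ T.monomialSpan R) (hm : m ∈ T.monomialSpan R) :
    w * m ∈ T.monomialSpan R := by
  induction hm using Submodule.span_induction with
  | mem m hm => obtain ⟨t, rfl⟩ := hm; exact h t
  | zero => simp
  | add m m' _ _ h h' => rw [mul_add]; exact add_mem h h'
  | smul r m _ h => rw [mul_smul_comm]; exact Submodule.smul_mem _ r h

/-- The algebra is spanned by the elements `s_α u_g s_β*`. -/
theorem mem_monomialSpan (x : T.ExelPardoAlgebra R) : x ∈ T.monomialSpan R := by
  obtain ⟨w, rfl⟩ := RingQuot.mkAlgHom_surjective R (T.Rel R) x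
  -- Membership in the span does not pass to products in an induction over words, but mapping the
  -- span into itself by left multiplication does. Membership follows by evaluating at 1.
  suffices h : ∀ m ∈ T.monomialSpan R, RingQuot.mkAlgHom R (T.Rel R) w * m ∈ T.monomialSpan R by
    simpa using h 1 one_mem_monomialSpan
  induction w using FreeAlgebra.induction with
  | grade0 r =>
    intro m hm
    rw [AlgHom.commutes, ← Algebra.smul_def]
    exact Submodule.smul_mem _ r hm
  | grade1 c =>
    intro m hm
    refine mul_mem_monomialSpan_of_monomial (fun t => ?_) hm
    cases c with
    | p x => exact p_mul_monomial_mem x t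
    | s a => exact sEdge_mul_monomial_mem a t
    | sStar a => exact sEdgeStar_mul_monomial_mem a t
    | u g => exact u_mul_monomial_mem g t
  | mul w v hw hv =>
    intro m hm
    rw [map_mul, mul_assoc]
    exact hw _ (hv m hm)
  | add w v hw hv =>
    intro m hm
    rw [map_add, add_mul]
    exact add_mem (hw m hm) (hv m hm)

end Algebra

section Homomorphism

variable {T : GraphTriple G V A} {R : Type*} [CommRing R]

/-! ### Products in the inverse semigroup -/

/-- With ε given explicitly and the product described by its components, each later product of
triples becomes a few equalities of vertices, lists and group elements, free of `remainder` and of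
dependent proofs. -/
theorem Triple.mul_eq_of_append {s t u : T.Triple} {ε : List A} (hr : t.α.rng = s.β.rng)
    (he : t.α.edges = s.β.edges ++ ε) (h1 : u.α.rng = s.α.rng)
    (h2 : u.α.edges = s.α.edges ++ T.act s.g ε) (h3 : u.g = T.coc s.g ε * t.g)
    (h4 : u.β = t.β) : s.mul t = some u := by
  have hp : s.β.IsPrefix t.α := ⟨hr.symm, ε, he.symm⟩
  have hε : s.β.remainder t.α = ε := by simp [FinPath.remainder, he]
  rw [Triple.mul, dif_pos hp]
  refine congrArg some (Triple.ext (FinPath.ext h1.symm ?_) ?_ h4.symm)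
  · simp [FinPath.extend, hε, h2]
  · simp [hε, h3]

theorem Triple.mul_eq_of_append' {s t u : T.Triple} {ε : List A} (hr : s.β.rng = t.α.rng)
    (he : s.β.edges = t.α.edges ++ ε) (h1 : u.β.rng = t.β.rng)
    (h2 : u.β.edges = t.β.edges ++ T.act t.g⁻¹ ε) (h3 : u.g = s.g * (T.coc t.g⁻¹ ε)⁻¹)
    (h4 : u.α = s.α) : s.mul t = some u := by
  -- For empty ε both prefix conditions hold and `Triple.mul` takes its first branch. The two
  -- formulas agree there.
  by_cases h : ε = []
  · subst h
    refine Triple.mul_eq_of_append (ε := []) hr.symm (by simpa using he.symm) (by rw [h4])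
      (by simp [h4]) (by simpa using h3) (FinPath.ext h1 (by simpa using h2))
  · have hp : t.α.IsPrefix s.β := ⟨hr.symm, ε, he.symm⟩
    have hp' : ¬ s.β.IsPrefix t.α := fun h' => h (by
      have := h'.2.length_le
      rw [he, List.length_append] at this
      exact List.eq_nil_of_length_eq_zero (by omega))
    have hε : t.α.remainder s.β = ε := by simp [FinPath.remainder, he]
    rw [Triple.mul, dif_neg hp', dif_pos hp]
    refine congrArg some (Triple.ext h4.symm ?_ (FinPath.ext h1.symm ?_))
    · simp [hε, h3]
    · simp [FinPath.extend, hε, h2]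

theorem Triple.mul_eq_none {s t : T.Triple} (h : ¬ s.β.IsPrefix t.α) (h' : ¬ t.α.IsPrefix s.β) :
    s.mul t = none := by
  rw [Triple.mul, dif_neg h, dif_neg h']

theorem Triple.mul_eq_none_of_rng_ne {s t : T.Triple} (h : s.β.rng ≠ t.α.rng) :
    s.mul t = none :=
  Triple.mul_eq_none (fun h' => h h'.1) (fun h' => h h'.1.symm)

/-! ### Products of characteristic functions in the Steinberg algebra -/

variable (T R) in
/-- The inclusion of the Steinberg algebra into the module of all functions. -/
noncomputable def coeFun [Finite A] : SteinbergAlgebra R T.InfPath →ₗ[R] (Quiver.Total T.InfPath → R) :=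
  (steinbergModule R T.InfPath).subtype

theorem coeFun_injective [Finite A] : Function.Injective (coeFun T R) := Subtype.val_injective

/-! ### Triples attached to vertices, edges, paths and group elements -/

variable (T) in
/-- The path of length zero at the vertex `x`. -/
def vertexPath (x : V) : T.FinPath := ⟨x, [], trivial⟩

variable (T) in
/-- The path of length one that consists of the edge `a`. -/
def edgePath (a : A) : T.FinPath := ⟨T.r a, [a], rfl, trivial⟩

variable (T) in
/-- The triple `(g x, g, x)`. -/
def unitTriple (g : G) (x : V) : T.Triple := ⟨T.vertexPath (g • x), g, T.vertexPath x, rfl⟩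

/-- The triple `(α, 1, d(α))`. -/
def FinPath.toTriple (α : T.FinPath) : T.Triple := ⟨α, 1, T.vertexPath α.d, (one_smul G _).symm⟩

/-- At each η in Z(γ) the idempotents of γ and of the range of η both have level data (η|ₙ, 1) for
large n, so their germs agree, and the latter is the unit at η. -/
theorem Theta_idem (γ : T.FinPath) :
    Theta (idem γ) γ = (fun η : T.InfPath => (⟨η, η, 𝟙 η⟩ : Quiver.Total T.InfPath)) ''
      cylinder γ := by
  have key : ∀ {η : T.InfPath} (h : η ∈ cylinder γ), germ (idem γ) (idem_maps h) = 𝟙 η := by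
    intro η h
    refine (germ_eq_iff_lev _ _).2 ?_
    filter_upwards [lev_idem h, lev_idem (η.mem_cylinder_initSeg 0)] with n h1 h2
    rw [h1, h2]
  ext ⟨x, y, a⟩
  constructor
  · rintro ⟨hx, h, e⟩
    dsimp only at hx h e
    obtain rfl := h.unique (idem_maps hx)
    exact ⟨y, hx, by rw [e, key hx]⟩
  · rintro ⟨η, h, e⟩
    rw [← e]
    exact ⟨h, idem_maps h, (key h).symm⟩

theorem idem_vertexPath_eq (x : V) : idem (T.vertexPath x) = T.unitTriple 1 x :=
  Triple.ext (FinPath.ext (one_smul G x).symm rfl) rfl rfl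

theorem image_left_Theta (s : T.Triple) :
    Quiver.Total.left '' Theta s s.β = cylinder s.β := by
  ext η
  constructor
  · rintro ⟨c, hc, rfl⟩
    exact hc.1
  · intro h
    obtain ⟨μ, hμ⟩ := Triple.exists_maps h
    exact ⟨⟨η, μ, germ s hμ⟩, ⟨h, hμ, rfl⟩, rfl⟩

variable [Fintype V] [Fintype A]

theorem charTheta_mul_of_some {s t u : T.Triple} (h : s.mul t = some u) :
    charTheta R s * charTheta R t = charTheta R u :=
  Subtype.ext <| (conv_indicator (Theta_isBisection t _)).trans <| by
    rw [setMul_Theta_of_some h]; rfl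

theorem charTheta_mul_of_none {s t : T.Triple} (h : s.mul t = none) :
    charTheta R s * charTheta R t = 0 :=
  Subtype.ext <| (conv_indicator (Theta_isBisection t _)).trans <| by
    rw [setMul_Theta_of_none h]; exact Set.indicator_empty _

variable (R) in
/-- The characteristic function of the set of germs `[g x, g, x; η]`, with `x` the range
of `η`. -/
noncomputable def charUnit (T : GraphTriple G V A) (g : G) : SteinbergAlgebra R T.InfPath :=
  ∑ x : V, charTheta R (T.unitTriple g x)

/-- Among the summands (gx, g, x) only the one with x the range of α has a nonzero product with (α,
h, β). That product is (gα, φ(g, α)h, β). -/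
theorem charUnit_mul (g : G) (t u : T.Triple) (h1 : u.α.rng = g • t.α.rng)
    (h2 : u.α.edges = T.act g t.α.edges) (h3 : u.g = T.coc g t.α.edges * t.g)
    (h4 : u.β = t.β) : charUnit R T g * charTheta R t = charTheta R u := by
  rw [charUnit, Finset.sum_mul, Finset.sum_eq_single t.α.rng]
  · exact charTheta_mul_of_some (Triple.mul_eq_of_append (ε := t.α.edges) rfl rfl h1 h2 h3 h4)
  · intro x _ hx
    exact charTheta_mul_of_none (Triple.mul_eq_none_of_rng_ne hx)
  · simp

/-- The mirror image of `charUnit_mul`: a summand (gx, g, x) survives only if gx is the range of β,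
which is why g⁻¹ acts on β. -/
theorem mul_charUnit (g : G) (t u : T.Triple) (h1 : u.β.rng = g⁻¹ • t.β.rng)
    (h2 : u.β.edges = T.act g⁻¹ t.β.edges) (h3 : u.g = t.g * (T.coc g⁻¹ t.β.edges)⁻¹)
    (h4 : u.α = t.α) : charTheta R t * charUnit R T g = charTheta R u := by
  rw [charUnit, Finset.mul_sum, Finset.sum_eq_single (g⁻¹ • t.β.rng)]
  · exact charTheta_mul_of_some (Triple.mul_eq_of_append' (ε := t.β.edges)
      (smul_inv_smul g t.β.rng).symm rfl h1 h2 h3 h4)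
  · intro x _ hx
    refine charTheta_mul_of_none (Triple.mul_eq_none_of_rng_ne fun h => hx ?_)
    rw [h]; exact (inv_smul_smul g x).symm
  · simp

/-- At g = 1 the summands are the characteristic functions of the units over the cylinders Z(x).
These partition the unit space, since every infinite path has exactly one range. -/
theorem charUnit_one : charUnit R T 1 = 1 := by
  have e : ∀ x : V, T.unitTriple 1 x = idem (T.vertexPath x) := fun x =>
    Triple.ext (FinPath.ext (one_smul G x) rfl) rfl rfl
  refine Subtype.ext ?_
  change coeFun T R _ = (unitArrows T.InfPath).indicator 1
  classical
  rw [charUnit, map_sum]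
  funext c
  rw [Finset.sum_apply]
  have hc : ∀ x : V, coeFun T R (charTheta R (T.unitTriple 1 x)) c =
      ((fun η : T.InfPath => (⟨η, η, 𝟙 η⟩ : Quiver.Total T.InfPath)) ''
        cylinder (T.vertexPath x)).indicator (1 : Quiver.Total T.InfPath → R) c := fun x => by
    rw [e, ← Theta_idem]; rfl
  simp only [hc]
  by_cases hu : c ∈ unitArrows T.InfPath
  · rw [Set.indicator_of_mem hu]
    obtain ⟨η, rfl⟩ := hu
    rw [Finset.sum_eq_single η.rng]
    · exact Set.indicator_of_mem (Set.mem_image_of_mem _ (η.mem_cylinder_initSeg 0)) _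
    · intro x _ hx
      refine Set.indicator_of_notMem ?_ _
      rintro ⟨ξ, h, h'⟩
      have h2 : ξ = η := congrArg Quiver.Total.left h'
      subst h2
      exact hx (mem_cylinder.1 h).1.symm
    · simp
  · rw [Set.indicator_of_notMem hu]
    refine Finset.sum_eq_zero fun x _ => Set.indicator_of_notMem ?_ _
    rintro ⟨η, -, h⟩
    exact hu ⟨η, h⟩

open Classical in
-- The Cuntz-Krieger relation at x in geometric form: sorting the paths in Z(x) by their first edge
-- splits Z(x) into the disjoint sets Z(a) with r(a) = x.
theorem sum_charTheta_idem_edgePath (x : V) :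
    ∑ a : A with T.r a = x, charTheta R (idem (T.edgePath a)) =
      charTheta R (idem (T.vertexPath x)) := by
  refine coeFun_injective ?_
  rw [map_sum]
  funext c
  rw [Finset.sum_apply]
  have hc : ∀ γ : T.FinPath, coeFun T R (charTheta R (idem γ)) c =
      ((fun η : T.InfPath => (⟨η, η, 𝟙 η⟩ : Quiver.Total T.InfPath)) ''
        cylinder γ).indicator (1 : Quiver.Total T.InfPath → R) c := fun γ => by
    rw [← Theta_idem]; rfl
  have hm : ∀ (η : T.InfPath) (a : A), η ∈ cylinder (T.edgePath a) ↔ η.seq 0 = a := by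
    intro η a
    rw [mem_cylinder]
    have : η.seq.take (T.edgePath a).edges.length = [η.seq 0] := rfl
    rw [this]
    exact ⟨fun h => (List.cons.inj h.2).1, fun h => by rw [InfPath.rng, h]; exact ⟨rfl, rfl⟩⟩
  have hv : ∀ (η : T.InfPath) (x : V), η ∈ cylinder (T.vertexPath x) ↔ η.rng = x := by
    intro η x
    rw [mem_cylinder]
    exact ⟨fun h => h.1, fun h => ⟨h, rfl⟩⟩
  simp only [hc]
  by_cases hu : c ∈ (fun η : T.InfPath => (⟨η, η, 𝟙 η⟩ : Quiver.Total T.InfPath)) ''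
      cylinder (T.vertexPath x)
  · rw [Set.indicator_of_mem hu]
    obtain ⟨η, hη, rfl⟩ := hu
    rw [Finset.sum_eq_single (η.seq 0)]
    · exact Set.indicator_of_mem (Set.mem_image_of_mem _ ((hm η _).2 rfl)) _
    · intro a _ ha
      refine Set.indicator_of_notMem ?_ _
      rintro ⟨ξ, h, h'⟩
      have h2 : ξ = η := congrArg Quiver.Total.left h'
      subst h2
      exact ha ((hm _ _).1 h).symm
    · intro h
      exact (h (Finset.mem_filter.2 ⟨Finset.mem_univ _, (hv η x).1 hη⟩)).elim
  · rw [Set.indicator_of_notMem hu]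
    refine Finset.sum_eq_zero fun a ha => Set.indicator_of_notMem ?_ _
    rintro ⟨η, h, h'⟩
    refine hu ⟨η, (hv η x).2 ?_, h'⟩
    rw [← (Finset.mem_filter.1 ha).2, ← (hm η a).1 h]
    rfl

/-! ### The homomorphism from the Exel-Pardo algebra to the Steinberg algebra -/

variable (R) in
/-- The elements of the Steinberg algebra that correspond to the generators of the Exel-Pardo
algebra. -/
noncomputable def genImage : T.Gen → SteinbergAlgebra R T.InfPath
  | .p x => charTheta R (idem (T.vertexPath x))
  | .s a => charTheta R (T.edgePath a).toTriple
  | .sStar a => charTheta R (T.edgePath a).toTriple.star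
  | .u g => charUnit R T g

theorem charTheta_idem_mul {x : V} {t : T.Triple} (h : t.α.rng = x) :
    charTheta R (idem (T.vertexPath x)) * charTheta R t = charTheta R t := by
  refine charTheta_mul_of_some (Triple.mul_eq_of_append (ε := t.α.edges) h rfl h ?_ ?_ rfl) <;>
  simp [idem, vertexPath]

theorem charTheta_mul_idem {x : V} {t : T.Triple} (h : t.β.rng = x) :
    charTheta R t * charTheta R (idem (T.vertexPath x)) = charTheta R t := by
  refine charTheta_mul_of_some (Triple.mul_eq_of_append' (ε := t.β.edges) h rfl h ?_ ?_ rfl) <;>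
  simp [idem, vertexPath]

theorem lift_genImage_eq_of_rel {x y : FreeAlgebra R T.Gen} (h : T.Rel R x y) :
    FreeAlgebra.lift R (genImage R (T := T)) x = FreeAlgebra.lift R (genImage R (T := T)) y := by
  classical
  induction h with
  | p_mul_p x y =>
    simp only [fp, map_mul, FreeAlgebra.lift_ι_apply, genImage]
    split_ifs with h
    · subst h
      rw [FreeAlgebra.lift_ι_apply]
      exact charTheta_idem_mul rfl
    · rw [map_zero]
      exact charTheta_mul_of_none (Triple.mul_eq_none_of_rng_ne h)
  | sum_p =>
    simp only [fp, map_sum, FreeAlgebra.lift_ι_apply, genImage, map_one, idem_vertexPath_eq]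
    exact charUnit_one
  | p_mul_s a =>
    simp only [fp, fs, map_mul, FreeAlgebra.lift_ι_apply, genImage]
    exact charTheta_idem_mul rfl
  | s_mul_p a =>
    simp only [fp, fs, map_mul, FreeAlgebra.lift_ι_apply, genImage]
    exact charTheta_mul_idem rfl
  | sStar_mul_p a =>
    simp only [fp, fsStar, map_mul, FreeAlgebra.lift_ι_apply, genImage]
    exact charTheta_mul_idem rfl
  | p_mul_sStar a =>
    simp only [fp, fsStar, map_mul, FreeAlgebra.lift_ι_apply, genImage]
    exact charTheta_idem_mul rfl
  | sStar_mul_s a b =>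
    simp only [fs, fsStar, map_mul, FreeAlgebra.lift_ι_apply, genImage]
    split_ifs with h
    · subst h
      rw [fp, FreeAlgebra.lift_ι_apply]
      refine charTheta_mul_of_some (Triple.mul_eq_of_append (ε := []) rfl rfl rfl rfl ?_ rfl)
      simp [idem, Triple.star, FinPath.toTriple]
    · rw [map_zero]
      refine charTheta_mul_of_none (Triple.mul_eq_none ?_ ?_) <;>
      rintro ⟨-, h'⟩
      · exact h (List.cons.inj (h'.eq_of_length rfl)).1
      · exact h (List.cons.inj (h'.eq_of_length rfl)).1.symm
  | sum_s x =>
    simp only [fs, fsStar, fp, map_sum, map_mul, FreeAlgebra.lift_ι_apply, genImage]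
    rw [← sum_charTheta_idem_edgePath]
    refine Finset.sum_congr rfl fun a _ => ?_
    refine charTheta_mul_of_some (Triple.mul_eq_of_append (ε := []) rfl rfl rfl rfl ?_ rfl)
    simp [idem, Triple.star, FinPath.toTriple]
  | u_one =>
    simp only [fu, FreeAlgebra.lift_ι_apply, genImage, map_one]
    exact charUnit_one
  | u_mul g h =>
    simp only [fu, map_mul, FreeAlgebra.lift_ι_apply, genImage]
    rw [charUnit, charUnit.eq_1 R T h, Finset.mul_sum]
    exact Finset.sum_congr rfl fun x _ =>
      (charUnit_mul g (T.unitTriple h x) (T.unitTriple (g * h) x) (mul_smul g h x) rfl rfl rfl).symm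
  | u_mul_s g a =>
    simp only [fu, fs, map_mul, FreeAlgebra.lift_ι_apply, genImage]
    -- The common value of both sides: (ga, φ(g, a), s(a)) is reached from u_g s_a and from s_{ga}
    -- u_{φ(g, a)}.
    let w : T.Triple := ⟨T.edgePath (g • a), T.φ g a, T.vertexPath (T.s a), by
      change T.s (g • a) = T.φ g a • T.s a
      rw [T.s_smul, T.φ_smul]⟩
    rw [charUnit_mul g (T.edgePath a).toTriple w (T.r_smul g a) rfl (mul_one _).symm rfl,
      mul_charUnit (T.φ g a) (T.edgePath (g • a)).toTriple w ?_ rfl ?_ rfl]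
    · change T.s a = (T.φ g a)⁻¹ • T.s (g • a)
      rw [T.s_smul, ← T.φ_smul g a, inv_smul_smul]
    · simp [w, FinPath.toTriple, vertexPath]
  | sStar_mul_u g a =>
    simp only [fu, fsStar, map_mul, FreeAlgebra.lift_ι_apply, genImage]
    have h : T.s a = (T.φ g a)⁻¹ • T.s (g • a) := by
      rw [T.s_smul, ← T.φ_smul g a, inv_smul_smul]
    -- Again the common value of both sides, the adjoint of the triple for the previous relation.
    let w : T.Triple := ⟨T.vertexPath (T.s a), (T.φ g a)⁻¹, T.edgePath (g • a), h⟩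
    rw [charUnit_mul (T.φ g a)⁻¹ (T.edgePath (g • a)).toTriple.star w h rfl ?_ rfl,
      mul_charUnit g⁻¹ (T.edgePath a).toTriple.star w ?_ ?_ ?_ rfl]
    · simp [w, FinPath.toTriple, edgePath, Triple.star, T.r_smul]
    · simp [w, FinPath.toTriple, edgePath, Triple.star, act]
    · simp [w, FinPath.toTriple, edgePath, Triple.star, coc]
    · simp [w, FinPath.toTriple, vertexPath, Triple.star]
  | u_mul_p g x =>
    simp only [fu, fp, map_mul, FreeAlgebra.lift_ι_apply, genImage]
    rw [charUnit_mul g (idem (T.vertexPath x)) (T.unitTriple g x) rfl rfl ?_ rfl,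
      mul_charUnit g (idem (T.vertexPath (g • x))) (T.unitTriple g x) ?_ rfl ?_ rfl] <;>
    simp [unitTriple, idem, vertexPath]

variable (T R) in
/-- The homomorphism from the Exel-Pardo algebra to the Steinberg algebra. -/
noncomputable def toSteinberg : T.ExelPardoAlgebra R →ₐ[R] SteinbergAlgebra R T.InfPath :=
  RingQuot.liftAlgHom R ⟨FreeAlgebra.lift R (genImage R), fun _ _ => lift_genImage_eq_of_rel⟩

/-! ### Values of the homomorphism on generators, paths and monomials -/

theorem toSteinberg_p (x : V) :
    T.toSteinberg R (T.p R x) = charTheta R (idem (T.vertexPath x)) := by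
  simp [toSteinberg, p, fp, genImage]

theorem toSteinberg_sEdge (a : A) :
    T.toSteinberg R (T.sEdge R a) = charTheta R (T.edgePath a).toTriple := by
  simp [toSteinberg, sEdge, fs, genImage]

theorem toSteinberg_sEdgeStar (a : A) :
    T.toSteinberg R (T.sEdgeStar R a) = charTheta R (T.edgePath a).toTriple.star := by
  simp [toSteinberg, sEdgeStar, fsStar, genImage]

theorem toSteinberg_u (g : G) : T.toSteinberg R (T.u R g) = charUnit R T g := by
  simp [toSteinberg, u, fu, genImage]

theorem toSteinberg_sPath (α : T.FinPath) :
    T.toSteinberg R (sPath R α) = charTheta R α.toTriple := by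
  obtain ⟨x, l, hl⟩ := α
  rw [sPath_eq]
  induction l generalizing x with
  | nil => rw [edgeProd_nil, mul_one, toSteinberg_p]; rfl
  | cons a l ih =>
    obtain rfl := hl.1
    -- Inserting p_{s(a)} gives the tail the form required by the induction hypothesis, also when
    -- the tail is empty. What is left is (a, 1, s(a)) (α, 1, d(α)) = (aα, 1, d(α)).
    rw [p_mul_edgeProd_cons rfl, edgeProd_cons, ← sEdge_mul_p, mul_assoc, map_mul, ih _ hl.2,
      toSteinberg_sEdge]
    refine charTheta_mul_of_some (Triple.mul_eq_of_append (ε := l) rfl rfl rfl ?_ ?_ rfl) <;>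
    simp [FinPath.toTriple, edgePath]

theorem toSteinberg_sPathStar (α : T.FinPath) :
    T.toSteinberg R (sPathStar R α) = charTheta R α.toTriple.star := by
  obtain ⟨x, l, hl⟩ := α
  rw [sPathStar_eq]
  induction l generalizing x with
  | nil =>
    rw [edgeStarProd_nil, one_mul, toSteinberg_p]
    exact congrArg _ (Triple.ext rfl inv_one.symm rfl)
  | cons a l ih =>
    obtain rfl := hl.1
    rw [edgeStarProd_cons_mul_p rfl, edgeStarProd_cons, ← p_mul_sEdgeStar, ← mul_assoc, map_mul,
      ih _ hl.2, toSteinberg_sEdgeStar]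
    refine charTheta_mul_of_some (Triple.mul_eq_of_append' (ε := l) rfl rfl rfl ?_ ?_ rfl) <;>
    simp [FinPath.toTriple, edgePath, Triple.star]

/-- The three factors multiply as (α, 1, d(α)) · u_g = (α, g, d(β)), and then (α, g, d(β)) (d(β), 1,
β) = (α, g, β). All overlaps have length zero, so the cocycle contributes only g. -/
theorem toSteinberg_monomial (t : T.Triple) :
    T.toSteinberg R (monomial R t) = charTheta R t := by
  rw [monomial, map_mul, map_mul, toSteinberg_sPath, toSteinberg_sPathStar, toSteinberg_u,
    mul_charUnit t.g t.α.toTriple ⟨t.α, t.g, T.vertexPath t.β.d, t.d_eq⟩ ?_ rfl ?_ rfl]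
  · refine charTheta_mul_of_some (Triple.mul_eq_of_append (ε := []) rfl rfl rfl ?_ ?_ rfl) <;>
    simp [FinPath.toTriple, Triple.star]
  · change t.β.d = t.g⁻¹ • t.α.d
    rw [t.d_eq, inv_smul_smul]
  · simp [FinPath.toTriple, vertexPath]

/-! ### Surjectivity -/

variable (R) in
/-- The characteristic function of the set `B` of arrows lies in the range of the homomorphism from
the Exel-Pardo algebra. -/
def IsAttained (B : Set (Quiver.Total T.InfPath)) : Prop :=
  ∃ x : T.ExelPardoAlgebra R, coeFun T R (T.toSteinberg R x) = B.indicator 1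

/-- If `D` is the set of units over the sources of `C`, and `C ∪ Θ_s` is a bisection, then the
characteristic function of `C ∪ Θ_s` is `1_C + 1_{Θ_s} * (1 - 1_D)`. -/
theorem IsAttained.union_Theta {s : T.Triple} {C : Set (Quiver.Total T.InfPath)} {Y : Set T.InfPath}
    (hC : IsAttained R C) (hY : Quiver.Total.left '' C = Y)
    (hD : IsAttained R ((fun η : T.InfPath => (⟨η, η, 𝟙 η⟩ : Quiver.Total T.InfPath)) '' Y))
    (hB : Set.InjOn Quiver.Total.left (C ∪ Theta s s.β)) :
    IsAttained R (C ∪ Theta s s.β) := by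
  classical
  obtain ⟨x, hx⟩ := hC
  obtain ⟨y, hy⟩ := hD
  have hD' : IsBisection ((fun η : T.InfPath => (⟨η, η, 𝟙 η⟩ : Quiver.Total T.InfPath)) '' Y) :=
    ⟨isBisection_unitArrows.1.mono (Set.image_subset_range _ _),
      isBisection_unitArrows.2.mono (Set.image_subset_range _ _)⟩
  -- Multiplying by the units over Y on the right keeps the germs with source in Y. Such a germ
  -- shares its source with an element of C, so by injectivity on the union it is that element.
  have hm : setMul (Theta s s.β)
      ((fun η : T.InfPath => (⟨η, η, 𝟙 η⟩ : Quiver.Total T.InfPath)) '' Y) =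
      Theta s s.β ∩ C := by
    ext c
    constructor
    · rintro ⟨z, d, b, h, hb, ⟨η, hη, e⟩⟩
      obtain ⟨l, r, c⟩ := c
      dsimp only at d b h hb e
      simp only [Quiver.Total.mk.injEq] at e
      obtain ⟨rfl, rfl, e⟩ := e
      obtain rfl := eq_of_heq e
      rw [Category.id_comp] at h
      subst h
      refine ⟨hb, ?_⟩
      rw [← hY] at hη
      obtain ⟨c', hc', e'⟩ := hη
      rwa [← hB (Or.inl hc') (Or.inr hb) e']
    · rintro ⟨hb, hc⟩
      exact ⟨c.left, 𝟙 _, c.hom, Category.id_comp _, hb, c.left, hY ▸ ⟨c, hc, rfl⟩, rfl⟩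
  refine ⟨x + monomial R s - monomial R s * y, ?_⟩
  have h1 : coeFun T R (T.toSteinberg R (monomial R s * y)) =
      (Theta s s.β ∩ C).indicator 1 := by
    rw [map_mul, toSteinberg_monomial, ← hm, ← conv_indicator hD', ← hy]
    rfl
  have h2 : coeFun T R (T.toSteinberg R (monomial R s)) = (Theta s s.β).indicator 1 := by
    rw [toSteinberg_monomial]
    rfl
  rw [map_sub, map_add, map_sub, map_add, h1, h2, hx]
  funext c
  by_cases h3 : c ∈ C <;> by_cases h4 : c ∈ Theta s s.β <;> simp [h3, h4]

/-- Sets of units come first because they are the sets D needed for general bisections. For units C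
coincides with its own D, so the induction feeds on itself. -/
theorem isAttained_units {S : Set T.FinPath} (hS : S.Finite) :
    IsAttained R ((fun η : T.InfPath => (⟨η, η, 𝟙 η⟩ : Quiver.Total T.InfPath)) ''
      ⋃ γ ∈ S, cylinder γ) := by
  induction S, hS using Set.Finite.induction_on with
  | empty => exact ⟨0, by rw [map_zero, map_zero]; simp; rfl⟩
  | @insert γ S _ hS ih =>
    have e : (fun η : T.InfPath => (⟨η, η, 𝟙 η⟩ : Quiver.Total T.InfPath)) ''
        (⋃ δ ∈ insert γ S, cylinder δ) =
        ((fun η : T.InfPath => (⟨η, η, 𝟙 η⟩ : Quiver.Total T.InfPath)) ''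
          ⋃ δ ∈ S, cylinder δ) ∪ Theta (idem γ) (idem γ).β := by
      rw [Set.biUnion_insert, Set.image_union, Set.union_comm]
      exact congrArg _ (Theta_idem γ).symm
    rw [e]
    -- The induction hypothesis serves both as C and as D.
    refine ih.union_Theta ?_ ih ?_
    · rw [Set.image_image, Set.image_id']
    · rw [← e]
      exact isBisection_unitArrows.1.mono (Set.image_subset_range _ _)

/-- The sources of a finite union of sets Θ_s form a finite union of cylinders, so
`isAttained_units` supplies the units over them at every step of the induction. -/
theorem isAttained_of_injOn {S : Set T.Triple} (hS : S.Finite)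
    (h : Set.InjOn Quiver.Total.left (⋃ s ∈ S, Theta s s.β)) :
    IsAttained R (⋃ s ∈ S, Theta s s.β) := by
  induction S, hS using Set.Finite.induction_on with
  | empty => exact ⟨0, by rw [map_zero, map_zero]; simp; rfl⟩
  | @insert s S _ hS ih =>
    rw [Set.biUnion_insert, Set.union_comm] at h ⊢
    refine (ih (h.mono Set.subset_union_left)).union_Theta (Y := ⋃ γ ∈ Triple.β '' S, cylinder γ)
      ?_ (isAttained_units (hS.image _)) h
    simp only [Set.image_iUnion, image_left_Theta, Set.biUnion_image]

theorem toSteinberg_surjective : Function.Surjective (T.toSteinberg R) := by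
  rintro ⟨f, hf⟩
  suffices h : ∃ x, coeFun T R (T.toSteinberg R x) = f by
    obtain ⟨x, hx⟩ := h
    exact ⟨x, Subtype.ext hx⟩
  induction hf using Submodule.span_induction with
  | mem f hf =>
    obtain ⟨B, h1, h2, h3, rfl⟩ := hf
    obtain ⟨S, hS, rfl⟩ := (isCompact_open_iff_eq_finite_iUnion_of_isTopologicalBasis
      (fun s : T.Triple => Theta s s.β) isTopologicalBasis_Theta isCompact_Theta B).1 ⟨h2, h1⟩
    exact isAttained_of_injOn hS h3.1
  | zero => exact ⟨0, by rw [map_zero, map_zero]⟩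
  | add f g _ _ hf hg =>
    obtain ⟨x, rfl⟩ := hf
    obtain ⟨y, rfl⟩ := hg
    exact ⟨x + y, by rw [map_add, map_add]⟩
  | smul r f _ hf =>
    obtain ⟨x, rfl⟩ := hf
    exact ⟨r • x, by rw [map_smul, map_smul]⟩

end Homomorphism

section Injectivity

variable {T : GraphTriple G V A} {R : Type*} [CommRing R] [Fintype V] [Fintype A]

/-! ### Injectivity -/

theorem p_mul_edgeProd {x : V} {l : List A} (h : T.IsPath x l) (hl : l ≠ []) :
    T.p R x * T.edgeProd R l = T.edgeProd R l := by
  cases l with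
  | nil => exact absurd rfl hl
  | cons a l => exact p_mul_edgeProd_cons h.1 l

/-- If `η ∈ Z(β)`, then for large `n` the product of `s_α u_g s_β*` with `s_{η|ₙ}` depends only on
the germ of `(α, g, β)` at `η`. -/
theorem monomial_mul_edgeProd_take {t : T.Triple} {η μ : T.InfPath} (h : t.Maps η μ) :
    ∀ᶠ n in atTop, monomial R t * T.edgeProd R (η.seq.take n) =
      T.edgeProd R (t.lev η n).1 * T.u R (t.lev η n).2 := by
  obtain ⟨ξ, h1, h2, -⟩ := h
  -- One edge beyond β keeps the rest of η|ₙ nonempty, so that its edge product, and the one that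
  -- results, absorb the projections at d(β) and at the range of α.
  filter_upwards [eventually_ge_atTop (t.β.edges.length + 1)] with n hn
  obtain ⟨m, rfl⟩ := Nat.exists_eq_add_of_le hn
  rw [add_assoc, t.lev_add h2, h2, stream_take_append, monomial_eq, edgeProd_append]
  have hε : T.IsPath t.β.d (ξ.seq.take (1 + m)) := h1 ▸ (ξ.isPath_take _).1
  have hε0 : ξ.seq.take (1 + m) ≠ [] := fun h0 => by simpa using congrArg List.length h0
  have hα : T.IsPath t.α.rng (t.α.edges ++ T.act t.g (ξ.seq.take (1 + m))) := by
    refine isPath_append.2 ⟨t.α.valid, ?_⟩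
    have := isPath_act t.g hε
    rwa [← t.d_eq] at this
  have hα0 : t.α.edges ++ T.act t.g (ξ.seq.take (1 + m)) ≠ [] := fun h0 => by
    have := congrArg List.length h0
    simp at this
  have e1 : T.edgeStarProd R t.β.edges * T.p R t.β.rng * T.edgeProd R t.β.edges *
      T.edgeProd R (ξ.seq.take (1 + m)) = T.edgeProd R (ξ.seq.take (1 + m)) := by
    rw [edgeStarProd_mul_edgeProd t.β.valid]
    exact p_mul_edgeProd hε hε0
  rw [mul_assoc _ (_ * T.p R t.β.rng), ← mul_assoc (_ * T.p R t.β.rng), e1, mul_assoc _ (T.u R _),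
    u_mul_edgeProd]
  simp only [← mul_assoc]
  rw [mul_assoc (T.p R _), ← edgeProd_append, p_mul_edgeProd hα hα0]

/-- Once η|ₙ is longer than β, it fails to extend β for one of two reasons: the ranges differ, and
orthogonal projections meet, or the edges of β are no prefix, and s_β* s_{η|ₙ} vanishes. -/
theorem monomial_mul_edgeProd_take_of_notMem {t : T.Triple} {η : T.InfPath}
    (h : η ∉ cylinder t.β) :
    ∀ᶠ n in atTop, monomial R t * T.edgeProd R (η.seq.take n) = 0 := by
  filter_upwards [eventually_ge_atTop (t.β.edges.length + 1)] with n hn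
  obtain ⟨k, rfl⟩ : ∃ k, n = k + 1 := ⟨n - 1, by omega⟩
  suffices e : T.edgeStarProd R t.β.edges * (T.p R t.β.rng * T.edgeProd R (η.seq.take (k + 1))) = 0 by
    rw [monomial_eq, mul_assoc, mul_assoc (T.edgeStarProd R _), e, mul_zero]
  by_cases hr : η.rng = t.β.rng
  · rw [← hr, p_mul_edgeProd (η.isPath_take _).1 (fun h0 => by simpa using congrArg List.length h0)]
    refine edgeStarProd_mul_edgeProd_eq_zero (by simp; omega) fun hp => h ?_
    rw [mem_cylinder]
    refine ⟨hr, ?_⟩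
    have := List.prefix_iff_eq_take.1 hp
    rw [Stream'.take_take, min_eq_right (by omega)] at this
    exact this.symm
  · have e : η.seq.take (k + 1) = η.seq 0 :: (η.seq.drop 1).take k := rfl
    rw [e, edgeProd_cons, ← mul_assoc (T.p R _), p_mul_sEdge_of_ne (Ne.symm hr), zero_mul, mul_zero]

variable (R) in
/-- The germ at infinity of the sequence `x s_{η|ₙ}`. -/
def tailGerm (η : T.InfPath) :
    T.ExelPardoAlgebra R →ₗ[R] Filter.Germ (atTop : Filter ℕ) (T.ExelPardoAlgebra R) where
  toFun x := ((fun n => x * T.edgeProd R (η.seq.take n) : ℕ → T.ExelPardoAlgebra R) :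
    Filter.Germ atTop (T.ExelPardoAlgebra R))
  map_add' x y := by
    rw [← Filter.Germ.coe_add]
    refine congrArg _ (funext fun n => ?_)
    exact add_mul _ _ _
  map_smul' r x := by
    rw [RingHom.id_apply, ← Filter.Germ.coe_smul]
    refine congrArg _ (funext fun n => ?_)
    exact smul_mul_assoc _ _ _

/-- Equal germs have equal level data for large n, and these data determine the products with
s_{η|ₙ}. This is what lets `tailGerm` factor through germs. -/
theorem tailGerm_eq_of_germRel {s t : T.Triple} {η μ : T.InfPath} (hs : s.Maps η μ)
    (ht : t.Maps η μ) (h : germ s hs = germ t ht) :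
    tailGerm R η (monomial R s) = tailGerm R η (monomial R t) := by
  refine Filter.Germ.coe_eq.2 ?_
  filter_upwards [(germ_eq_iff_lev hs ht).1 h, monomial_mul_edgeProd_take (R := R) hs,
    monomial_mul_edgeProd_take (R := R) ht] with n h1 h2 h3
  rw [h2, h3, h1]

open Classical in
variable (R) in
/-- The characteristic function of the germ of `t` at `η`, which is zero if `η ∉ Z(β)`. -/
noncomputable def germSingle (η : T.InfPath) (t : T.Triple) : Quiver.Total T.InfPath →₀ R :=
  if h : η ∈ cylinder t.β then
    Finsupp.single ⟨η, (Triple.exists_maps h).choose, germ t (Triple.exists_maps h).choose_spec⟩ 1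
  else 0

open Classical in
-- Since Θ_t is a bisection, it has at most one arrow with source η. The restriction of its
-- characteristic function to the arrows from η is therefore a single basis vector or zero.
theorem germSingle_apply (η : T.InfPath) (t : T.Triple) (a : Quiver.Total T.InfPath) :
    germSingle R η t a = if a.left = η then coeFun T R (charTheta R t) a else 0 := by
  have e : coeFun T R (charTheta R t) a = (Theta t t.β).indicator 1 a := rfl
  rw [e, germSingle]
  obtain ⟨x, y, a⟩ := a
  by_cases h : η ∈ cylinder t.β
  · rw [dif_pos h]
    have hm := (Triple.exists_maps h).choose_spec
    by_cases hx : x = η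
    · subst hx
      rw [if_pos rfl]
      by_cases ha : (⟨x, y, a⟩ : Quiver.Total T.InfPath) ∈ Theta t t.β
      · rw [Set.indicator_of_mem ha]
        have : (⟨x, _, germ t hm⟩ : Quiver.Total T.InfPath) = ⟨x, y, a⟩ :=
          (Theta_isBisection t t.β).1 ⟨h, hm, rfl⟩ ha rfl
        rw [this, Finsupp.single_eq_same]
        rfl
      · rw [Set.indicator_of_notMem ha, Finsupp.single_eq_of_ne]
        rintro e
        exact ha (e ▸ ⟨h, hm, rfl⟩)
    · rw [if_neg hx, Finsupp.single_eq_of_ne]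
      exact fun e => hx (congrArg Quiver.Total.left e)
  · rw [dif_neg h]
    split_ifs with hx
    · subst hx
      rw [Set.indicator_of_notMem fun ha => h ha.1]
      rfl
    · rfl

/-- Restriction to the arrows with source η is linear, so a linear relation among characteristic
functions survives it. The relation now lives in the free module on arrows, out of which maps may be
defined germ by germ. -/
theorem linearCombination_germSingle_eq_zero (η : T.InfPath) {c : T.Triple →₀ R}
    (hc : Finsupp.linearCombination R (charTheta R) c = 0) :
    Finsupp.linearCombination R (germSingle R η) c = 0 := by
  classical
  ext a
  have key : Finsupp.lapply a ∘ₗ Finsupp.linearCombination R (germSingle R η) =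
      (if a.left = η then (1 : R) else 0) • (LinearMap.proj a ∘ₗ coeFun T R ∘ₗ
        Finsupp.linearCombination R (charTheta R)) := by
    refine Finsupp.lhom_ext fun t r => ?_
    by_cases ha : a.left = η <;> simp [ha, Finsupp.linearCombination_single, germSingle_apply]
  have := LinearMap.congr_fun key c
  simp only [LinearMap.comp_apply, LinearMap.smul_apply, hc, map_zero, smul_zero] at this
  exact this

/-- An element of the kernel of the homomorphism to the Steinberg algebra is annihilated by the
initial segments of every infinite path. -/
theorem eventually_mul_edgeProd_take_eq_zero {x : T.ExelPardoAlgebra R}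
    (hx : T.toSteinberg R x = 0) (η : T.InfPath) :
    ∀ᶠ n in atTop, x * T.edgeProd R (η.seq.take n) = 0 := by
  classical
  obtain ⟨c, rfl⟩ := (Finsupp.mem_span_range_iff_exists_finsupp).1 (mem_monomialSpan x)
  change T.toSteinberg R (Finsupp.linearCombination R (monomial R) c) = 0 at hx
  change ∀ᶠ n in atTop, Finsupp.linearCombination R (monomial R) c *
    T.edgeProd R (η.seq.take n) = 0
  have hc : Finsupp.linearCombination R (charTheta R) c = 0 := by
    rw [← hx, ← AlgHom.toLinearMap_apply, Finsupp.apply_linearCombination]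
    congr 2
    funext t
    exact (toSteinberg_monomial t).symm
  -- The chosen representative is harmless for arrows from η, by `tailGerm_eq_of_germRel`. The
  -- values at arrows with another source are arbitrary and never enter, as `germSingle R η` is
  -- supported on arrows from η.
  let H : Quiver.Total T.InfPath → Filter.Germ (atTop : Filter ℕ) (T.ExelPardoAlgebra R) :=
    fun a => tailGerm R η (monomial R (exists_germ a.hom).choose)
  -- The behaviour of a combination of monomials along η factors through its germs at η, where the
  -- combination `c` is already zero.
  have key : tailGerm R η ∘ₗ Finsupp.linearCombination R (monomial R) =
      Finsupp.linearCombination R H ∘ₗ Finsupp.linearCombination R (germSingle R η) := by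
    refine Finsupp.lhom_ext fun t r => ?_
    simp only [LinearMap.comp_apply, Finsupp.linearCombination_single, map_smul]
    congr 1
    rw [germSingle]
    split_ifs with h
    · rw [Finsupp.linearCombination_single, one_smul]
      obtain ⟨h', e⟩ := (exists_germ (germ t (Triple.exists_maps h).choose_spec)).choose_spec
      exact tailGerm_eq_of_germRel _ h' e
    · rw [map_zero]
      exact Filter.Germ.coe_eq.2 (monomial_mul_edgeProd_take_of_notMem h)
  have := LinearMap.congr_fun key c
  rw [LinearMap.comp_apply, LinearMap.comp_apply, linearCombination_germSingle_eq_zero η hc,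
    map_zero] at this
  exact Filter.Germ.coe_eq.1 this

/-! ### Infinite paths that detect nonzero elements -/

/-- By the Cuntz-Krieger relation y p_v is the sum of the y s_a s_a* with r(a) = v, so not all y s_a
can vanish. -/
theorem exists_mul_sEdge_ne_zero {y : T.ExelPardoAlgebra R} {v : V} (h : y * T.p R v ≠ 0) :
    ∃ a : A, T.r a = v ∧ y * T.sEdge R a ≠ 0 := by
  classical
  by_contra! H
  refine h ?_
  rw [← sum_sEdge_mul_sEdgeStar, Finset.mul_sum]
  refine Finset.sum_eq_zero fun a ha => ?_
  rw [← mul_assoc, H a (Finset.mem_filter.1 ha).2, zero_mul]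

/-- A nonzero element is not annihilated by the initial segments of some infinite path. -/
theorem exists_infPath_mul_edgeProd_ne_zero {x : T.ExelPardoAlgebra R} (hx : x ≠ 0) :
    ∃ η : T.InfPath, ∀ n, x * T.edgeProd R (η.seq.take n) ≠ 0 := by
  obtain ⟨v, hv⟩ : ∃ v, x * T.p R v ≠ 0 := by
    by_contra! H
    refine hx ?_
    rw [← mul_one x, ← sum_p_eq_one, Finset.mul_sum]
    exact Finset.sum_eq_zero fun v _ => H v
  -- A state holds the product formed so far and the vertex where the next edge must begin. Its
  -- invariant survives a step because s_a p_{s(a)} = s_a, and the recorded vertex makes consecutive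
  -- edges composable.
  let S := {q : T.ExelPardoAlgebra R × V // q.1 * T.p R q.2 ≠ 0}
  choose e he he' using fun q : S => exists_mul_sEdge_ne_zero q.2
  let next : S → S := fun q => ⟨(q.1.1 * T.sEdge R (e q), T.s (e q)), by
    rw [mul_assoc, sEdge_mul_p]; exact he' q⟩
  let st : ℕ → S := fun n => next^[n] ⟨(x, v), hv⟩
  have hst : ∀ n, st (n + 1) = next (st n) := fun n => Function.iterate_succ_apply' next n _
  let η : T.InfPath := ⟨fun n => e (st n), fun n => by rw [he, hst]⟩
  have key : ∀ n, (st n).1.1 = x * T.edgeProd R (η.seq.take n) := by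
    intro n
    induction n with
    | zero => exact (mul_one x).symm
    | succ n ih =>
      rw [Stream'.take_succ', edgeProd_append, ← mul_assoc, ← ih, hst, edgeProd_cons, edgeProd_nil,
        mul_one]
      rfl
  refine ⟨η, fun n h => (st n).2 ?_⟩
  rw [key, h, zero_mul]

/-- The bound from which x s_{η|ₙ} vanishes may depend on η. No uniformity is needed, since one path
along which the products never vanish contradicts it. -/
theorem toSteinberg_injective : Function.Injective (T.toSteinberg R) := by
  rw [injective_iff_map_eq_zero]
  intro x hx
  by_contra h
  obtain ⟨η, hη⟩ := exists_infPath_mul_edgeProd_ne_zero h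
  obtain ⟨n, hn⟩ := (eventually_mul_edgeProd_take_eq_zero hx η).exists
  exact hη n hn

end Injectivity

end GraphTriple

end ExelPardo

theorem theorem6p4 {G V A : Type*} [Group G] [MulAction G V] [MulAction G A] [Fintype V]
    [Fintype A] (T : ExelPardo.GraphTriple G V A) (R : Type*) [CommRing R] :
    ∃ Φ : ExelPardo.SteinbergAlgebra R T.InfPath ≃ₐ[R] T.ExelPardoAlgebra R,
      ∀ s : T.Triple,
        Φ (ExelPardo.GraphTriple.charTheta R s) =
          ExelPardo.GraphTriple.sPath R s.α * T.u R s.g * ExelPardo.GraphTriple.sPathStar R s.β := by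
  refine ⟨(AlgEquiv.ofBijective (T.toSteinberg R) ⟨ExelPardo.GraphTriple.toSteinberg_injective,
    ExelPardo.GraphTriple.toSteinberg_surjective⟩).symm, fun s => ?_⟩
  rw [AlgEquiv.symm_apply_eq]
  exact (ExelPardo.GraphTriple.toSteinberg_monomial s).symm
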